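/- Let $k$ be a field and let $A$ be the canonical algebra over $k$ given by integers $n\ge 2$ and $p_1,\dots,p_n\ge 1$ and by $\lambda_3,\dots,\lambda_n\in k\setminus\{0\}$: $A$ is the path algebra of the quiver with a source $0$, a sink $\vec c$ and, for $i=1,\dots,n$, an arm $$0\xrightarrow{x_i}\vec x_i\xrightarrow{2x_i}2\vec x_i\to\cdots\to(p_i-1)\vec x_i\xrightarrow{p_ix_i}\vec c$$ with $p_i$ arrows, modulo the relations $x_i^{p_i}=x_1^{p_1}+\lambda_i x_2^{p_2}$ for $i\ge 3$, where $x_i^{p_i}$ denotes the path from $0$ to $\vec c$ along the $i$-th arm. Modules are right $A$-modules. Identify $K_0(A)$ with $\mathbb Z^{Q_0}$ ($Q_0$ the set of vertices) by sending a finite dimensional module $M$ to its dimension vector $[M]=(\dim_k Me_v)_{v}$, and let $\mathbf 1\in K_0(A)$ be the vector with all entries $1$. Let $D=\operatorname{Hom}_k(-,k)$. (a) For all finite dimensional $A$-modules $X,Y$ the spaces $\operatorname{Ext}^i_A(X,Y)$ are finite dimensional and vanish for all large $i$, and $\sum_i(-1)^i\dim_k\operatorname{Ext}^i_A(X,Y)$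 depends only on $[X],[Y]$ and is the value $\langle [X],[Y]\rangle$ of a bilinear form on $K_0(A)$, the Euler form. (b) Let $M$ be (the module underlying) a $k$-point of the Serre stable moduli stack $\mathbb X^S$ for the dimension vector $\mathbf 1$ and shift parameter $1$; that is, $[M]=\mathbf 1$ and $M\simeq (M\otimes^{\mathbf L}_A DA)[-1]$, i.e. $\operatorname{Tor}^A_i(M,DA)=0$ for $i\ne 1$ and $\operatorname{Tor}_1^A(M,DA)\simeq M$ as right $A$-modules. Then $M$ is regular semisimple with respect to $\langle\mathbf 1,-\rangle$: it is a finite direct sum of regular simple modules, where a nonzero finite dimensional module $X$ is regular simple if $\langle\mathbf 1,[X]\rangle=0$ and $\langle\mathbf 1,[N]\rangle<0$ for every nonzero proper submodule $N$ of $X$. (c) Moreover, if $M$ is as in (b), then $\langle\mathbf 1,[N]\rangle=-1$ for every nonzero proper submodule $N$ of an indecomposable direct summand of $M$. -/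

import Mathlib

universe u

open CategoryTheory CategoryTheory.Abelian MulOpposite
open scoped TensorProduct ModuleCat

namespace SerreStable

noncomputable section

/-! ### Modules over an algebra: the Nakayama functor and the Euler characteristic

A right `A`-module is an `Aᵐᵒᵖ`-module, `m · a` being `op a • m`. -/

section Nakayama

variable (k : Type u) [Field k] (A : Type u) [Ring A] [Algebra k A]

/-- The dual `DA = Hom_k(A, k)`, an `A`-`A`-bimodule by `(a f b)(x) = f (b x a)`. -/
def DualBimodule : Type u := A →ₗ[k] k

namespace DualBimodule

instance : AddCommGroup (DualBimodule k A) := inferInstanceAs (AddCommGroup (A →ₗ[k] k))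

instance : Module k (DualBimodule k A) := inferInstanceAs (Module k (A →ₗ[k] k))

instance : FunLike (DualBimodule k A) A k := inferInstanceAs (FunLike (A →ₗ[k] k) A k)

variable {k A}

@[ext] theorem ext {f g : DualBimodule k A} (h : ∀ x, f x = g x) : f = g :=
  LinearMap.ext h

@[simp] theorem add_apply (f g : DualBimodule k A) (x : A) : (f + g) x = f x + g x := rfl

@[simp] theorem zero_apply (x : A) : (0 : DualBimodule k A) x = 0 := rfl

@[simp] theorem smul_apply (c : k) (f : DualBimodule k A) (x : A) : (c • f) x = c * f x := rfl

@[simp] theorem map_add' (f : DualBimodule k A) (x y : A) : f (x + y) = f x + f y :=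
  LinearMap.map_add (show A →ₗ[k] k from f) x y

@[simp] theorem map_zero' (f : DualBimodule k A) : f 0 = 0 :=
  LinearMap.map_zero (show A →ₗ[k] k from f)

@[simp] theorem map_smul' (f : DualBimodule k A) (c : k) (x : A) : f (c • x) = c * f x :=
  LinearMap.map_smul (show A →ₗ[k] k from f) c x

/-- The left action `(a f)(x) = f (x a)`. -/
instance : SMul A (DualBimodule k A) :=
  ⟨fun a f => (show A →ₗ[k] k from f) ∘ₗ LinearMap.mulRight k a⟩

/-- The right action `(f b)(x) = f (b x)`. -/
instance : SMul Aᵐᵒᵖ (DualBimodule k A) :=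
  ⟨fun b f => (show A →ₗ[k] k from f) ∘ₗ LinearMap.mulLeft k b.unop⟩

@[simp] theorem left_smul_apply (a : A) (f : DualBimodule k A) (x : A) :
    (a • f) x = f (x * a) := rfl

@[simp] theorem right_smul_apply (b : Aᵐᵒᵖ) (f : DualBimodule k A) (x : A) :
    (b • f) x = f (b.unop * x) := rfl

instance : Module A (DualBimodule k A) where
  one_smul f := by ext x; simp
  mul_smul a b f := by ext x; simp [mul_assoc]
  smul_zero a := by ext x; simp
  smul_add a f g := by ext x; simp
  add_smul a b f := by ext x; simp [mul_add]
  zero_smul f := by ext x; simp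

instance : Module Aᵐᵒᵖ (DualBimodule k A) where
  one_smul f := by ext x; simp
  mul_smul a b f := by ext x; simp [mul_assoc]
  smul_zero a := by ext x; simp
  smul_add a f g := by ext x; simp
  add_smul a b f := by ext x; simp [add_mul]
  zero_smul f := by ext x; simp

instance : SMulCommClass A Aᵐᵒᵖ (DualBimodule k A) :=
  ⟨fun a b f => by ext x; simp [mul_assoc]⟩

instance : SMulCommClass k Aᵐᵒᵖ (DualBimodule k A) :=
  ⟨fun c b f => by ext x; simp⟩

instance : SMulCommClass Aᵐᵒᵖ k (DualBimodule k A) := SMulCommClass.symm _ _ _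

instance : IsScalarTower k Aᵐᵒᵖ (DualBimodule k A) :=
  ⟨fun c b f => by ext x; simp⟩

end DualBimodule

variable {A}

/-- The submodule of `DA ⊗_k M` by which one divides to get `M ⊗_A DA`; the two factors are
written in the opposite order, so that `f ⊗ₜ m` stands for `m ⊗ f`. -/
def balancing (M : ModuleCat.{u} Aᵐᵒᵖ) : Submodule Aᵐᵒᵖ (DualBimodule k A ⊗[k] M) :=
  Submodule.span Aᵐᵒᵖ
    {t | ∃ (m : M) (a : A) (f : DualBimodule k A), t = f ⊗ₜ[k] (op a • m) - (a • f) ⊗ₜ[k] m}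

/-- The map `DA ⊗_k M → DA ⊗_k N` induced by a map of right modules `M → N`. -/
def dualTensorMap {M N : ModuleCat.{u} Aᵐᵒᵖ} (g : M ⟶ N) :
    DualBimodule k A ⊗[k] M →ₗ[Aᵐᵒᵖ] DualBimodule k A ⊗[k] N :=
  TensorProduct.AlgebraTensorModule.lTensor Aᵐᵒᵖ (DualBimodule k A) (g.hom.restrictScalars k)

@[simp] theorem dualTensorMap_tmul {M N : ModuleCat.{u} Aᵐᵒᵖ} (g : M ⟶ N)
    (f : DualBimodule k A) (m : M) :
    dualTensorMap k g (f ⊗ₜ[k] m) = f ⊗ₜ[k] g.hom m := rfl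

theorem dualTensorMap_id (M : ModuleCat.{u} Aᵐᵒᵖ) (t : DualBimodule k A ⊗[k] M) :
    dualTensorMap k (𝟙 M) t = t := by
  induction t using TensorProduct.induction_on with
  | zero => simp
  | tmul f m => simp
  | add x y hx hy => rw [map_add, hx, hy]

theorem dualTensorMap_comp {M N P : ModuleCat.{u} Aᵐᵒᵖ} (g : M ⟶ N) (h : N ⟶ P)
    (t : DualBimodule k A ⊗[k] M) :
    dualTensorMap k (g ≫ h) t = dualTensorMap k h (dualTensorMap k g t) := by
  induction t using TensorProduct.induction_on with
  | zero => simp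
  | tmul f m => simp
  | add x y hx hy => simp only [map_add, hx, hy]

theorem dualTensorMap_add {M N : ModuleCat.{u} Aᵐᵒᵖ} (g h : M ⟶ N)
    (t : DualBimodule k A ⊗[k] M) :
    dualTensorMap k (g + h) t = dualTensorMap k g t + dualTensorMap k h t := by
  induction t using TensorProduct.induction_on with
  | zero => simp
  | tmul f m => simp [TensorProduct.tmul_add]
  | add x y hx hy => rw [map_add, map_add, map_add, hx, hy]; abel

theorem balancing_le {M N : ModuleCat.{u} Aᵐᵒᵖ} (g : M ⟶ N) :
    balancing k M ≤ (balancing k N).comap (dualTensorMap k g) := by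
  refine Submodule.span_le.2 ?_
  rintro _ ⟨m, a, f, rfl⟩
  refine Submodule.subset_span ⟨g.hom m, a, f, ?_⟩
  simp

variable (A)

/-- The functor `- ⊗_A DA` on right `A`-modules. -/
def tensorDual : ModuleCat.{u} Aᵐᵒᵖ ⥤ ModuleCat.{u} Aᵐᵒᵖ where
  obj M := ModuleCat.of Aᵐᵒᵖ ((DualBimodule k A ⊗[k] M) ⧸ balancing k M)
  map g := ModuleCat.ofHom (Submodule.mapQ _ _ (dualTensorMap k g) (balancing_le k g))
  map_id M := by
    refine ModuleCat.hom_ext (LinearMap.ext fun x => ?_)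
    obtain ⟨t, rfl⟩ := Submodule.Quotient.mk_surjective _ x
    exact congrArg _ (dualTensorMap_id k M t)
  map_comp g h := by
    refine ModuleCat.hom_ext (LinearMap.ext fun x => ?_)
    obtain ⟨t, rfl⟩ := Submodule.Quotient.mk_surjective _ x
    exact congrArg _ (dualTensorMap_comp k g h t)

instance : (tensorDual k A).Additive where
  map_add {M N g h} := by
    refine ModuleCat.hom_ext (LinearMap.ext fun x => ?_)
    obtain ⟨t, rfl⟩ := Submodule.Quotient.mk_surjective _ x
    exact congrArg _ (dualTensorMap_add k g h t)

variable {A}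

/-- A right module `M` with `ν_d M ≃ M`, where `ν_d = (- ⊗ᴸ_A DA)[-d]`: the homology
`h_i(M ⊗ᴸ_A DA) = Tor_i^A(M, DA)` vanishes for `i ≠ d`, and is isomorphic to `M` for `i = d`. -/
def IsSerreStable (d : ℕ) (M : ModuleCat.{u} Aᵐᵒᵖ) : Prop :=
  (∀ i : ℕ, i ≠ d → Limits.IsZero (((tensorDual k A).leftDerived i).obj M)) ∧
    Nonempty (M ≅ ((tensorDual k A).leftDerived d).obj M)

/-- `∑_i (-1)^i dim_k Ext^i_A(X, Y)`. -/
def eulerChar (X Y : ModuleCat.{u} Aᵐᵒᵖ) : ℤ :=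
  ∑ᶠ i : ℕ, (-1 : ℤ) ^ i * (Module.finrank k (Ext X Y i) : ℤ)

end Nakayama

/-! ### Canonical algebras -/

/-- The data of a canonical algebra: `n ≥ 2` arms, of lengths `p i ≥ 1`, and a parameter
`lam i ≠ 0` for every arm but the first two (the values `lam 0` and `lam 1` play no role). -/
structure CanonicalDatum (k : Type u) [Field k] where
  n : ℕ
  two_le : 2 ≤ n
  p : Fin n → ℕ
  one_le : ∀ i, 1 ≤ p i
  lam : Fin n → k
  lam_ne_zero : ∀ i : Fin n, 2 ≤ i.val → lam i ≠ 0

/-- The vertices of the canonical quiver with arms of lengths `p i`: the source `0`, the sink `c`,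
and `mid i a`, for `a + 1 < p i`, which is the vertex `(a + 1) xᵢ` of the arm `i`. -/
inductive Vertex {n : ℕ} (p : Fin n → ℕ) : Type
  | zero : Vertex p
  | mid (i : Fin n) (a : Fin (p i - 1)) : Vertex p
  | c : Vertex p
  deriving DecidableEq, Fintype

/-- The arrows: `⟨i, a⟩` is the arrow `(a + 1) xᵢ`, from `a xᵢ` to `(a + 1) xᵢ`. -/
abbrev Arrow {n : ℕ} (p : Fin n → ℕ) : Type := Σ i : Fin n, Fin (p i)

/-- The vertex `a xᵢ`, where `0 xᵢ = 0` and `(p i) xᵢ = c`. -/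
def vertexAt {n : ℕ} (p : Fin n → ℕ) (i : Fin n) (a : ℕ) : Vertex p :=
  if a = 0 then Vertex.zero
  else if h : a - 1 < p i - 1 then Vertex.mid i ⟨a - 1, h⟩
  else Vertex.c

def source {n : ℕ} {p : Fin n → ℕ} (α : Arrow p) : Vertex p := vertexAt p α.1 α.2.val

def target {n : ℕ} {p : Fin n → ℕ} (α : Arrow p) : Vertex p := vertexAt p α.1 (α.2.val + 1)

namespace CanonicalDatum

variable {k : Type u} [Field k] (C : CanonicalDatum k)

/-- Generators of the algebra: the idempotents of the vertices and the arrows. -/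
abbrev Free : Type u := FreeAlgebra k (Vertex C.p ⊕ Arrow C.p)

def freeIdem (v : Vertex C.p) : C.Free := FreeAlgebra.ι k (Sum.inl v)

def freeArrow (α : Arrow C.p) : C.Free := FreeAlgebra.ι k (Sum.inr α)

/-- The path `xᵢ^{p i}` from `0` to `c` along the arm `i`, written from left to right. -/
def freeArm (i : Fin C.n) : C.Free :=
  (List.ofFn fun a : Fin (C.p i) => C.freeArrow ⟨i, a⟩).prod

/-- The first two arms. -/
def arm0 : Fin C.n := ⟨0, lt_of_lt_of_le Nat.zero_lt_two C.two_le⟩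

def arm1 : Fin C.n := ⟨1, lt_of_lt_of_le Nat.one_lt_two C.two_le⟩

/-- The relations of the path algebra of the quiver (paths are composed from left to right), and
the canonical relations `xᵢ^{p i} = x₁^{p 1} + lam i • x₂^{p 2}` for all arms but the first two. -/
inductive Rel : C.Free → C.Free → Prop
  | idem (v : Vertex C.p) : Rel (C.freeIdem v * C.freeIdem v) (C.freeIdem v)
  | orth (v w : Vertex C.p) (h : v ≠ w) : Rel (C.freeIdem v * C.freeIdem w) 0
  | one : Rel (∑ v, C.freeIdem v) 1
  | src (α : Arrow C.p) : Rel (C.freeIdem (source α) * C.freeArrow α) (C.freeArrow α)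
  | tgt (α : Arrow C.p) : Rel (C.freeArrow α * C.freeIdem (target α)) (C.freeArrow α)
  | canonical (i : Fin C.n) (hi : 2 ≤ i.val) :
      Rel (C.freeArm i) (C.freeArm C.arm0 + C.lam i • C.freeArm C.arm1)

/-- The canonical algebra. -/
abbrev Alg : Type u := RingQuot C.Rel

/-- Right modules over the canonical algebra. -/
abbrev RMod : Type (u + 1) := ModuleCat.{u} (C.Alg)ᵐᵒᵖ

/-- The idempotent of a vertex. -/
def idem (v : Vertex C.p) : C.Alg := RingQuot.mkAlgHom k C.Rel (C.freeIdem v)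

/-- The space `M e_v`. -/
def vertexSpace (M : C.RMod) (v : Vertex C.p) : Submodule k M where
  carrier := {m | op (C.idem v) • m = m}
  add_mem' {x y} hx hy := by
    simp only [Set.mem_ofPred_eq] at hx hy ⊢
    rw [smul_add, hx, hy]
  zero_mem' := smul_zero _
  smul_mem' c x hx := by
    simp only [Set.mem_ofPred_eq] at hx ⊢
    rw [← algebraMap_smul (C.Alg)ᵐᵒᵖ c x, ← mul_smul, ← Algebra.commutes, mul_smul, hx]

/-- The dimension vector of a module, which is its class in `K₀(A) = ℤ^{Q₀}`. -/
def dimVec (M : C.RMod) : Vertex C.p → ℤ := fun v => (Module.finrank k (C.vertexSpace M v) : ℤ)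

/-- The values on the generators of the character of `A` that is `1` on `e_v` and `0` on the other
idempotents and on the arrows. -/
def freeCharacter (v : Vertex C.p) : C.Free →ₐ[k] k :=
  FreeAlgebra.lift k (Sum.elim (fun w => if w = v then 1 else 0) (fun _ => 0))

@[simp] theorem freeCharacter_idem (v w : Vertex C.p) :
    C.freeCharacter v (C.freeIdem w) = if w = v then 1 else 0 := by
  simp [freeCharacter, freeIdem]

@[simp] theorem freeCharacter_arrow (v : Vertex C.p) (α : Arrow C.p) :
    C.freeCharacter v (C.freeArrow α) = 0 := by
  simp [freeCharacter, freeArrow]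

@[simp] theorem freeCharacter_arm (v : Vertex C.p) (i : Fin C.n) :
    C.freeCharacter v (C.freeArm i) = 0 := by
  rw [freeArm, map_list_prod, List.prod_eq_zero_iff, List.mem_map]
  exact ⟨C.freeArrow ⟨i, ⟨0, C.one_le i⟩⟩, by simp [List.mem_ofFn], by simp⟩

/-- The character of `A` by which it acts on the simple module of the vertex `v`. -/
def character (v : Vertex C.p) : C.Alg →ₐ[k] k :=
  RingQuot.liftAlgHom k ⟨C.freeCharacter v, by
    intro x y h
    induction h with
    | idem w => simp
    | orth w w' h =>
      rw [map_mul, map_zero, freeCharacter_idem, freeCharacter_idem]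
      split_ifs with h1 h2 <;> simp_all
    | one => simp
    | src α => simp
    | tgt α => simp
    | canonical i hi => simp⟩

/-- The simple module `S_v` of a vertex `v`. -/
def simple (v : Vertex C.p) : C.RMod :=
  (ModuleCat.restrictScalars
    ((C.character v).toRingHom.fromOpposite fun _ _ => mul_comm _ _)).obj (ModuleCat.of k k)

/-- The Euler form on `K₀(A) = ℤ^{Q₀}`: the bilinear form with
`⟨[S_v], [S_w]⟩ = ∑_i (-1)^i dim Ext^i(S_v, S_w)` on the basis of the classes of the simple
modules. -/
def eulerForm (x y : Vertex C.p → ℤ) : ℤ :=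
  ∑ v, ∑ w, x v * y w * eulerChar k (C.simple v) (C.simple w)

/-- `X` is regular simple with respect to `d`: it is a nonzero finite dimensional module with
`⟨d, [X]⟩ = 0`, and `⟨d, [N]⟩ < 0` for its nonzero proper submodules `N`. -/
def IsRegularSimple (d : Vertex C.p → ℤ) (X : C.RMod) : Prop :=
  Nontrivial X ∧ Module.Finite k X ∧ C.eulerForm d (C.dimVec X) = 0 ∧
    ∀ N : Submodule (C.Alg)ᵐᵒᵖ X, N ≠ ⊥ → N ≠ ⊤ →
      C.eulerForm d (C.dimVec (ModuleCat.of (C.Alg)ᵐᵒᵖ N)) < 0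

/-- `M` is regular semisimple with respect to `d`: it is a (finite) direct sum of regular
simples. -/
def IsRegularSemisimple (d : Vertex C.p → ℤ) (M : C.RMod) : Prop :=
  ∃ (r : ℕ) (Y : Fin r → Submodule (C.Alg)ᵐᵒᵖ M), DirectSum.IsInternal Y ∧
    ∀ j, C.IsRegularSimple d (ModuleCat.of (C.Alg)ᵐᵒᵖ (Y j))

/-- `L` is an indecomposable direct summand of `M`. -/
def IsIndecSummand (M : C.RMod) (L : Submodule (C.Alg)ᵐᵒᵖ M) : Prop :=
  L ≠ ⊥ ∧ (∃ L' : Submodule (C.Alg)ᵐᵒᵖ M, IsCompl L L') ∧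
    ∀ U W : Submodule (C.Alg)ᵐᵒᵖ M, Disjoint U W → U ⊔ W = L → U = ⊥ ∨ W = ⊥

/-- The modules `M` underlying the `k`-points `M ≃ ν₁ M` of the Serre stable moduli stack with
dimension vector `𝟏 = (1, …, 1)` and shift parameter `1`. -/
def IsKPoint (M : C.RMod) : Prop :=
  C.dimVec M = 1 ∧ IsSerreStable k 1 M

end CanonicalDatum

end

end SerreStable

/-!
Every right module `X` over the canonical algebra `A` has a projective resolution of length two, by
the arrows and the relations of the quiver, in analogy with the resolution of a module over a path
algebra:
`0 → ⨁_{relations} X e_0 ⊗ e_c A → ⨁_{α : v → w} X e_v ⊗ e_w A → ⨁_v X e_v ⊗ e_v A → X → 0`.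
Its first two differentials are `x ⊗ 1 ↦ x ⊗ α - x α ⊗ 1` on the summand of an arrow `α`, and the
derivative of the relation on the summand of a relation (`resD₁`, `resD₂`). Exactness in degree one
(`exact_resD₂_resD₁`) holds because linear maps `ξ α : X → Y`, one for each arrow, which satisfy the
derivatives of the relations are the values at the arrows of a derivation `A → Hom_k(X, Y)`
(`exists_derivation`). The injectivity of `resD₂` holds because the image of the generator of the
relation of the arm `i` has a component at the first arrow of that arm, where the images of the
generators of the other relations have none, and because left multiplication by the rest of the arm
is injective on `e_c A` (`idem_c_mul_eq_zero`). For a finite dimensional `X` the terms are finite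
direct sums, which gives the finiteness of the Ext groups, and the Euler characteristic as a
bilinear form in the dimension vectors (`extFinite_and_eulerChar`). On the vector `(1, …, 1)` this
form is `y ↦ y_0 - y_c` (`eulerForm_one`).

Applied to the resolution, the functor `- ⊗_A DA` replaces `e_v A` by `e_v DA = D(A e_v)`
(`projDual`, `dualCoord`), so that a Serre stable module `M` with shift `1` is isomorphic to the
homology in degree one of an explicit complex whose last differential is surjective. Consider two
consecutive arrows `α`, `β` of an arm, which meet in a vertex `w`. Right multiplication by `β` is
surjective from `DA e_w` onto `DA e_{t(β)}`, where `t(β)` is the target of `β`, and its kernel is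
spanned by the character of `w`. The complex of these kernels is the map `M e_{s(α)} → M e_w` given
by `α`, where `s(α)` is the source of `α`, so by the snake lemma `β` acts surjectively on the
homology if and only if `α` acts surjectively on `M`
(`exists_cycle_of_actsSurj`, `exists_smul_eq_of_cycle`). As the homology is `M`, and `M` has
one-dimensional spaces `M e_v`, the arrows of an arm act either all as isomorphisms or all as zero.
Surjectivity of the last differential yields an arrow ending at `c` that does not act as zero
(`exists_arrow_smul_ne_zero`), and therefore an arm of isomorphisms.

It follows that `M` is the direct sum of the simple modules at the vertices inside the arms that act
as zero, and of the block spanned by all other vertices. The first have no nonzero proper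
submodules. A nonzero submodule of the block contains `M e_c`, and it is the block as soon as it
contains `M e_0`, so for the proper ones the value of `y_0 - y_c` is `-1`
(`IsLive.of_lt_blockSpan`). A submodule of `M` is determined by the
vertices in it, and it follows that every indecomposable direct summand is a single block
(`IsLive.exists_eq_blockSpan`).
-/

namespace SerreStable

noncomputable section

set_option linter.unusedSectionVars false

namespace CanonicalDatum

variable {k : Type u} [Field k] (C : CanonicalDatum k)

/-! ### The canonical algebra by generators and relations -/

/-- The element of the canonical algebra given by an arrow. -/
def arr (α : Arrow C.p) : C.Alg := RingQuot.mkAlgHom k C.Rel (C.freeArrow α)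

/-- The product in the canonical algebra of a list of arrows. -/
def pathProd (l : List (Arrow C.p)) : C.Alg := (l.map C.arr).prod

/-- The arrows of the arm `i`, in order. -/
def armList (i : Fin C.n) : List (Arrow C.p) := List.ofFn fun a : Fin (C.p i) => ⟨i, a⟩

@[simp] theorem pathProd_nil : C.pathProd [] = 1 := rfl

@[simp] theorem pathProd_cons (α : Arrow C.p) (l : List (Arrow C.p)) :
    C.pathProd (α :: l) = C.arr α * C.pathProd l := by simp [pathProd]

theorem mkAlgHom_freeArm (i : Fin C.n) :
    RingQuot.mkAlgHom k C.Rel (C.freeArm i) = C.pathProd (C.armList i) := by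
  rw [freeArm, map_list_prod, pathProd, armList, List.map_ofFn, List.map_ofFn]
  rfl

theorem idem_mul_self (v : Vertex C.p) : C.idem v * C.idem v = C.idem v := by
  simpa [idem] using RingQuot.mkAlgHom_rel k (Rel.idem (C := C) v)

theorem idem_mul_of_ne {v w : Vertex C.p} (h : v ≠ w) : C.idem v * C.idem w = 0 := by
  simpa [idem] using RingQuot.mkAlgHom_rel k (Rel.orth (C := C) v w h)

theorem sum_idem : ∑ v, C.idem v = 1 := by
  simpa [idem] using RingQuot.mkAlgHom_rel k (Rel.one (C := C))

@[simp] theorem source_mul_arr (α : Arrow C.p) : C.idem (source α) * C.arr α = C.arr α := by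
  simpa [idem, arr] using RingQuot.mkAlgHom_rel k (Rel.src (C := C) α)

@[simp] theorem arr_mul_target (α : Arrow C.p) : C.arr α * C.idem (target α) = C.arr α := by
  simpa [idem, arr] using RingQuot.mkAlgHom_rel k (Rel.tgt (C := C) α)

theorem idem_mul_arr (v : Vertex C.p) (α : Arrow C.p) :
    C.idem v * C.arr α = if v = source α then C.arr α else 0 := by
  split_ifs with h
  · rw [h, source_mul_arr]
  · rw [← source_mul_arr, ← mul_assoc, C.idem_mul_of_ne h, zero_mul]

theorem idem_mul_idem (v w : Vertex C.p) :
    C.idem v * C.idem w = if v = w then C.idem v else 0 := by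
  split_ifs with h
  · rw [← h, idem_mul_self]
  · exact C.idem_mul_of_ne h

theorem pathProd_armList (i : Fin C.n) (hi : 2 ≤ i.val) :
    C.pathProd (C.armList i) =
      C.pathProd (C.armList C.arm0) + C.lam i • C.pathProd (C.armList C.arm1) := by
  simpa [mkAlgHom_freeArm] using RingQuot.mkAlgHom_rel k (Rel.canonical (C := C) i hi)

@[simp] theorem character_idem (v w : Vertex C.p) :
    C.character v (C.idem w) = if w = v then 1 else 0 := by
  simp [character, idem]

@[simp] theorem character_arr (v : Vertex C.p) (α : Arrow C.p) :
    C.character v (C.arr α) = 0 := by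
  simp [character, arr]

variable {C} in
/-- Induction over the elements of the canonical algebra. -/
@[elab_as_elim]
theorem alg_induction {P : C.Alg → Prop} (algebraMap : ∀ c : k, P (algebraMap k C.Alg c))
    (idem : ∀ v, P (C.idem v)) (arr : ∀ α, P (C.arr α))
    (mul : ∀ a b, P a → P b → P (a * b)) (add : ∀ a b, P a → P b → P (a + b)) (a : C.Alg) :
    P a := by
  obtain ⟨z, rfl⟩ := RingQuot.mkAlgHom_surjective k C.Rel a
  induction z using FreeAlgebra.induction with
  | grade0 r => rw [AlgHom.commutes]; exact algebraMap r
  | grade1 x =>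
    rcases x with v | α
    · exact idem v
    · exact arr α
  | mul a b ha hb => rw [map_mul]; exact mul _ _ ha hb
  | add a b ha hb => rw [map_add]; exact add _ _ ha hb

/-! ### Derivations with values in a space of linear maps -/

section Derivation

variable {X Y : Type*} [AddCommGroup X] [Module k X] [Module C.Algᵐᵒᵖ X]
  [IsScalarTower k C.Algᵐᵒᵖ X] [AddCommGroup Y] [Module k Y] [Module C.Algᵐᵒᵖ Y]
  [IsScalarTower k C.Algᵐᵒᵖ Y]

/-- Given linear maps `ξ α : X → Y` for the arrows `α`, the value at the path `l` of the
derivation `D` with `D α = ξ α`, by the Leibniz rule `D (a b) x = D a x · b + D b (x · a)`. -/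
def leibniz (ξ : Arrow C.p → X →ₗ[k] Y) : List (Arrow C.p) → X →ₗ[k] Y
  | [] => 0
  | α :: l => Algebra.lsmul k k Y (op (C.pathProd l)) ∘ₗ ξ α +
      leibniz ξ l ∘ₗ Algebra.lsmul k k X (op (C.arr α))

@[simp] theorem leibniz_nil (ξ : Arrow C.p → X →ₗ[k] Y) : C.leibniz ξ [] = 0 := rfl

@[simp] theorem leibniz_cons (ξ : Arrow C.p → X →ₗ[k] Y) (α : Arrow C.p)
    (l : List (Arrow C.p)) (x : X) :
    C.leibniz ξ (α :: l) x = op (C.pathProd l) • ξ α x + C.leibniz ξ l (op (C.arr α) • x) := rfl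

/-- The endomorphism `(y, x) ↦ (y · a + δ x, x · a)` of `Y × X`, in the opposite of the
endomorphism ring. -/
def triangular (a : C.Alg) (δ : X →ₗ[k] Y) : (Module.End k (Y × X))ᵐᵒᵖ :=
  op (LinearMap.prod
    (Algebra.lsmul k k Y (op a) ∘ₗ LinearMap.fst k Y X + δ ∘ₗ LinearMap.snd k Y X)
    (Algebra.lsmul k k X (op a) ∘ₗ LinearMap.snd k Y X))

theorem triangular_unop_apply (a : C.Alg) (δ : X →ₗ[k] Y) (z : Y × X) :
    (C.triangular a δ).unop z = (op a • z.1 + δ z.2, op a • z.2) := rfl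

theorem triangular_mul (a b : C.Alg) (δ ε : X →ₗ[k] Y) :
    C.triangular a δ * C.triangular b ε =
      C.triangular (a * b)
        (Algebra.lsmul k k Y (op b) ∘ₗ δ + ε ∘ₗ Algebra.lsmul k k X (op a)) := by
  refine unop_injective (LinearMap.ext fun z => ?_)
  rw [unop_mul, Module.End.mul_apply]
  simp only [triangular_unop_apply]
  simp [mul_smul, add_assoc]

theorem triangular_add (a b : C.Alg) (δ ε : X →ₗ[k] Y) :
    C.triangular a δ + C.triangular b ε = C.triangular (a + b) (δ + ε) := by
  refine unop_injective (LinearMap.ext fun z => ?_)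
  rw [MulOpposite.unop_add, LinearMap.add_apply]
  simp only [triangular_unop_apply]
  simp only [MulOpposite.op_add, add_smul, Prod.mk_add_mk, LinearMap.add_apply, Prod.mk.injEq,
    and_true]
  abel

theorem triangular_smul (c : k) (a : C.Alg) (δ : X →ₗ[k] Y) :
    c • C.triangular a δ = C.triangular (c • a) (c • δ) := by
  refine unop_injective (LinearMap.ext fun z => ?_)
  rw [unop_smul, LinearMap.smul_apply]
  simp only [triangular_unop_apply]
  simp [smul_add]

theorem triangular_one : C.triangular 1 (0 : X →ₗ[k] Y) = 1 := by
  refine unop_injective (LinearMap.ext fun z => ?_)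
  simp [triangular_unop_apply]

theorem triangular_zero : C.triangular 0 (0 : X →ₗ[k] Y) = 0 := by
  refine unop_injective (LinearMap.ext fun z => ?_)
  simp [triangular_unop_apply]

/-- Linear maps `ξ α : X → Y`, one for each arrow, that are compatible with the vertices and
with the canonical relations are the values at the arrows of a derivation `A → Hom_k(X, Y)` which
is zero at the idempotents: they define a right module structure on `Y × X`, in which `Y` is a
submodule and `X` the quotient. -/
theorem exists_derivation (ξ : Arrow C.p → X →ₗ[k] Y)
    (hs : ∀ α x, ξ α (op (C.idem (source α)) • x) = ξ α x)
    (ht : ∀ α x, op (C.idem (target α)) • ξ α x = ξ α x)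
    (hc : ∀ i : Fin C.n, 2 ≤ i.val → C.leibniz ξ (C.armList i) =
      C.leibniz ξ (C.armList C.arm0) + C.lam i • C.leibniz ξ (C.armList C.arm1)) :
    ∃ D : C.Alg →ₗ[k] X →ₗ[k] Y, (∀ a b x, D (a * b) x = op b • D a x + D b (op a • x)) ∧
      (∀ v, D (C.idem v) = 0) ∧ ∀ α, D (C.arr α) = ξ α := by
  let gen : Vertex C.p ⊕ Arrow C.p → (Module.End k (Y × X))ᵐᵒᵖ :=
    Sum.elim (fun v => C.triangular (C.idem v) 0) (fun α => C.triangular (C.arr α) (ξ α))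
  let φ₀ : C.Free →ₐ[k] (Module.End k (Y × X))ᵐᵒᵖ := FreeAlgebra.lift k gen
  have h_idem (v) : φ₀ (C.freeIdem v) = C.triangular (C.idem v) 0 := by
    simp [φ₀, gen, freeIdem]
  have h_arr (α) : φ₀ (C.freeArrow α) = C.triangular (C.arr α) (ξ α) := by
    simp [φ₀, gen, freeArrow]
  have h_path (l : List (Arrow C.p)) :
      φ₀ (l.map C.freeArrow).prod = C.triangular (C.pathProd l) (C.leibniz ξ l) := by
    induction l with
    | nil => simp [triangular_one]
    | cons α l ih =>
      rw [List.map_cons, List.prod_cons, map_mul, ih, h_arr, triangular_mul, pathProd_cons]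
      rfl
  have h_arm (i) : φ₀ (C.freeArm i) =
      C.triangular (C.pathProd (C.armList i)) (C.leibniz ξ (C.armList i)) := by
    rw [← h_path, armList, List.map_ofFn]
    rfl
  have h_rel ⦃z w : C.Free⦄ (h : C.Rel z w) : φ₀ z = φ₀ w := by
    induction h with
    | idem v => simp [h_idem, triangular_mul, idem_mul_self]
    | orth v w h => simp [h_idem, triangular_mul, C.idem_mul_of_ne h, triangular_zero]
    | one =>
      rw [map_sum, map_one]
      simp only [h_idem]
      have hsum (s : Finset (Vertex C.p)) :
          ∑ v ∈ s, C.triangular (C.idem v) (0 : X →ₗ[k] Y) =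
            C.triangular (∑ v ∈ s, C.idem v) 0 := by
        induction s using Finset.cons_induction with
        | empty => simp [triangular_zero]
        | cons v s hv ih =>
          rw [Finset.sum_cons, Finset.sum_cons, ih, triangular_add, add_zero]
      rw [hsum, sum_idem, triangular_one]
    | src α =>
      rw [map_mul, h_idem, h_arr, triangular_mul, source_mul_arr]
      congr 1
      ext x
      simp [hs]
    | tgt α =>
      rw [map_mul, h_idem, h_arr, triangular_mul, arr_mul_target]
      congr 1
      ext x
      simp [ht]
    | canonical i hi =>
      rw [map_add, map_smul, h_arm, h_arm, h_arm, triangular_smul, triangular_add,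
        ← hc i hi, ← C.pathProd_armList i hi]
  let φ : C.Alg →ₐ[k] (Module.End k (Y × X))ᵐᵒᵖ := RingQuot.liftAlgHom k ⟨φ₀, h_rel⟩
  have hφ (z) : φ (RingQuot.mkAlgHom k C.Rel z) = φ₀ z := by simp [φ]
  let D : C.Alg →ₗ[k] X →ₗ[k] Y :=
    { toFun a := LinearMap.fst k Y X ∘ₗ (φ a).unop ∘ₗ LinearMap.inr k Y X
      map_add' a b := by ext x; simp
      map_smul' c a := by ext x; simp }
  have hD_of {a : C.Alg} {δ : X →ₗ[k] Y} (h : φ a = C.triangular a δ) : D a = δ := by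
    ext x
    change ((φ a).unop (0, x)).1 = δ x
    simp [h, triangular_unop_apply]
  have key (a : C.Alg) : φ a = C.triangular a (D a) := by
    suffices ∃ δ, φ a = C.triangular a δ by
      obtain ⟨δ, h⟩ := this
      rw [hD_of h, h]
    induction a using alg_induction with
    | algebraMap c =>
      refine ⟨0, ?_⟩
      rw [AlgHom.commutes, Algebra.algebraMap_eq_smul_one, Algebra.algebraMap_eq_smul_one,
        ← C.triangular_one (X := X) (Y := Y), triangular_smul, smul_zero]
    | idem v => exact ⟨0, (hφ _).trans (h_idem v)⟩
    | arr α => exact ⟨ξ α, (hφ _).trans (h_arr α)⟩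
    | mul a b ha hb =>
      obtain ⟨δ, hδ⟩ := ha
      obtain ⟨ε, hε⟩ := hb
      exact ⟨_, by rw [map_mul, hδ, hε, triangular_mul]⟩
    | add a b ha hb =>
      obtain ⟨δ, hδ⟩ := ha
      obtain ⟨ε, hε⟩ := hb
      exact ⟨_, by rw [map_add, hδ, hε, triangular_add]⟩
  refine ⟨D, fun a b x => ?_, fun v => hD_of ((hφ _).trans (h_idem v)),
    fun α => hD_of ((hφ _).trans (h_arr α))⟩
  have h := map_mul φ a b
  rw [key a, key b, triangular_mul] at h
  rw [hD_of h]
  rfl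

end Derivation

/-! ### Paths along the arms -/

/-- The first arrow of the arm `i`. -/
def firstArrow (i : Fin C.n) : Arrow C.p := ⟨i, ⟨0, C.one_le i⟩⟩

@[simp] theorem source_firstArrow (i : Fin C.n) : source (C.firstArrow i) = Vertex.zero := rfl

theorem armList_eq_cons (i : Fin C.n) :
    C.armList i = C.firstArrow i :: (C.armList i).drop 1 := by
  have h : 0 < (C.armList i).length := by
    rw [armList, List.length_ofFn]
    exact C.one_le i
  conv_lhs => rw [← List.drop_zero (l := C.armList i), List.drop_eq_getElem_cons h]
  simp [armList, firstArrow]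

theorem drop_armList (i : Fin C.n) (a : Fin (C.p i)) :
    (C.armList i).drop a = ⟨i, a⟩ :: (C.armList i).drop (a + 1) := by
  have h : a.val < (C.armList i).length := by simp [armList]
  rw [List.drop_eq_getElem_cons h]
  simp [armList]

theorem vertexAt_length (i : Fin C.n) : vertexAt C.p i (C.p i) = Vertex.c := by
  have := C.one_le i
  rw [vertexAt, if_neg (by omega), dif_neg (by omega)]

theorem mem_armList {i : Fin C.n} {α : Arrow C.p} (h : α ∈ C.armList i) : α.1 = i := by
  rw [armList, List.mem_ofFn] at h
  obtain ⟨a, rfl⟩ := h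
  rfl

theorem firstArrow_notMem_drop (i : Fin C.n) : C.firstArrow i ∉ (C.armList i).drop 1 := by
  have h : (C.armList i).Nodup := List.nodup_ofFn.2 fun a b h => by simpa using h
  rw [armList_eq_cons] at h
  exact (List.nodup_cons.1 h).1

section Derivation

variable {X Y : Type*} [AddCommGroup X] [Module k X] [Module C.Algᵐᵒᵖ X]
  [IsScalarTower k C.Algᵐᵒᵖ X] [AddCommGroup Y] [Module k Y] [Module C.Algᵐᵒᵖ Y]
  [IsScalarTower k C.Algᵐᵒᵖ Y]

theorem leibniz_armList_idem_zero {ξ : Arrow C.p → X →ₗ[k] Y}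
    (hs : ∀ α x, ξ α (op (C.idem (source α)) • x) = ξ α x) (i : Fin C.n) (x : X) :
    C.leibniz ξ (C.armList i) (op (C.idem Vertex.zero) • x) = C.leibniz ξ (C.armList i) x := by
  rw [armList_eq_cons, leibniz_cons, leibniz_cons, ← mul_smul, ← op_mul,
    ← C.source_firstArrow i, hs, source_mul_arr]

theorem idem_c_leibniz_armList {ξ : Arrow C.p → X →ₗ[k] Y}
    (ht : ∀ α x, op (C.idem (target α)) • ξ α x = ξ α x) (i : Fin C.n) (x : X) :
    op (C.idem Vertex.c) • C.leibniz ξ (C.armList i) x = C.leibniz ξ (C.armList i) x := by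
  -- The statement holds for all paths along the arm which end at its last arrow.
  suffices h : ∀ m a : ℕ, a + m = C.p i →
      C.idem (vertexAt C.p i a) * C.pathProd ((C.armList i).drop a) * C.idem Vertex.c =
        C.idem (vertexAt C.p i a) * C.pathProd ((C.armList i).drop a) ∧
      ∀ x, op (C.idem Vertex.c) • C.leibniz ξ ((C.armList i).drop a) x =
        C.leibniz ξ ((C.armList i).drop a) x by
    simpa using (h (C.p i) 0 (zero_add _)).2 x
  intro m
  induction m with
  | zero =>
    rintro a rfl
    rw [List.drop_of_length_le (by simp [armList])]
    simp [vertexAt_length, idem_mul_self]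
  | succ m ih =>
    intro a ha
    obtain ⟨h1, h2⟩ := ih (a + 1) (by omega)
    have e := C.drop_armList i ⟨a, by omega⟩
    have htgt : C.arr ⟨i, ⟨a, by omega⟩⟩ * C.idem (vertexAt C.p i (a + 1)) =
      C.arr ⟨i, ⟨a, by omega⟩⟩ := C.arr_mul_target _
    have ht' : ∀ x, op (C.idem (vertexAt C.p i (a + 1))) • ξ ⟨i, ⟨a, by omega⟩⟩ x =
      ξ ⟨i, ⟨a, by omega⟩⟩ x := ht ⟨i, ⟨a, by omega⟩⟩
    simp only at e
    rw [e]
    refine ⟨?_, fun x => ?_⟩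
    · rw [pathProd_cons, ← htgt, mul_assoc (C.arr _), mul_assoc (C.idem _),
        mul_assoc (C.arr _), h1]
    · rw [leibniz_cons, smul_add, h2, ← ht']
      simp only [← mul_smul, ← op_mul]
      rw [h1]

end Derivation

/-- Left multiplication by an arrow that does not start at the source `0` is injective on
`e_t A`, where `t` is the target of the arrow: there is a derivation `A → Hom_k(S_v, A)`, where `v`
is the vertex at which the arrow starts, with the value `e_t` at the arrow and `0` at the others. -/
theorem idem_target_mul_eq_zero {β : Arrow C.p} (hβ : β.2.val ≠ 0) {x : C.Alg}
    (hx : C.arr β * x = 0) : C.idem (target β) * x = 0 := by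
  let _ : Module C.Algᵐᵒᵖ k := Module.compHom k
    ((C.character (source β)).toRingHom.fromOpposite fun _ _ => mul_comm _ _)
  have smul_def (a : C.Alg) (x : k) : op a • x = C.character (source β) a * x := rfl
  have : IsScalarTower k C.Algᵐᵒᵖ k := ⟨fun c a x => by
    induction a using MulOpposite.rec'
    rw [← op_smul, smul_def, smul_def, map_smul, smul_mul_assoc]⟩
  let ξ : Arrow C.p → k →ₗ[k] C.Alg := fun α =>
    if α = β then LinearMap.toSpanSingleton k C.Alg (C.idem (target β)) else 0
  have hleib (i) : C.leibniz ξ (C.armList i) = 0 := by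
    have hfirst : C.firstArrow i ≠ β := by
      rintro rfl
      exact hβ rfl
    ext
    rw [armList_eq_cons, leibniz_cons, smul_def]
    simp [ξ, hfirst]
  obtain ⟨D, hD, -, hD'⟩ := C.exists_derivation ξ
    (fun α x => by
      by_cases h : α = β
      · rw [h, smul_def, character_idem, if_pos rfl, one_mul]
      · simp [ξ, h])
    (fun α x => by
      by_cases h : α = β
      · simp [ξ, h, idem_mul_self]
      · simp [ξ, h])
    (fun i _ => by simp [hleib])
  have := hD (C.arr β) x 1
  rw [hx, hD', smul_def] at this
  simpa [ξ] using this.symm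

/-- The path from the vertex `a xᵢ`, `a ≠ 0`, to `c` is not annihilated by any nonzero element of
`e_c A`. -/
theorem idem_c_mul_eq_zero {i : Fin C.n} {a : ℕ} (ha : a ≠ 0) (hai : a ≤ C.p i) {x : C.Alg}
    (hx : C.idem (vertexAt C.p i a) * (C.pathProd ((C.armList i).drop a) * x) = 0) :
    C.idem Vertex.c * x = 0 := by
  obtain ⟨m, hm⟩ := Nat.exists_eq_add_of_le hai
  induction m generalizing a with
  | zero =>
    obtain rfl : a = C.p i := by omega
    rw [List.drop_of_length_le (by simp [armList])] at hx
    simpa [vertexAt_length] using hx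
  | succ m ih =>
    refine ih (a := a + 1) (by omega) (by omega) ?_ (by omega)
    have e := C.drop_armList i ⟨a, by omega⟩
    simp only at e
    rw [e, pathProd_cons, mul_assoc, ← mul_assoc] at hx
    change C.idem (source ⟨i, ⟨a, by omega⟩⟩) * _ * _ = 0 at hx
    rw [source_mul_arr] at hx
    exact C.idem_target_mul_eq_zero ha hx

/-! ### Projective modules -/

-- The instances of rings and modules take precedence over those of semirings and semimodules, so
-- that those of submodules and of spaces of linear maps are found by unification.
local instance : AddCommGroup C.Alg := Ring.toAddCommGroup
local instance : AddCommMonoid C.Alg := AddCommGroup.toAddCommMonoid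
local instance : Semiring C.Algᵐᵒᵖ := Ring.toSemiring
local instance : SMul k C.Alg := Algebra.toSMul

section Proj

variable {J : Type} (lam : J → Vertex C.p)

/-- The right module `∏_j e_{lam j} A`, as a submodule of `A^J`. -/
def proj : Submodule C.Algᵐᵒᵖ (J → C.Alg) where
  carrier := {g | ∀ j, C.idem (lam j) * g j = g j}
  add_mem' {g h} hg hh j := by rw [Pi.add_apply, mul_add, hg j, hh j]
  zero_mem' j := mul_zero _
  smul_mem' a g hg j := by
    rw [Pi.smul_apply, MulOpposite.smul_eq_mul_unop, ← mul_assoc, hg j]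

variable {C lam} in
theorem proj_apply (g : C.proj lam) (j : J) : C.idem (lam j) * g.1 j = g.1 j := g.2 j

variable [DecidableEq J]

/-- The generator `e_{lam j}` of the factor `j`. -/
def projGen (j : J) : C.proj lam :=
  ⟨Pi.single j (C.idem (lam j)), fun i => by
    by_cases h : i = j
    · subst h
      simp [idem_mul_self]
    · simp [h]⟩

theorem projGen_val (j i : J) :
    (C.projGen lam j).1 i = if i = j then C.idem (lam i) else 0 := by
  by_cases h : i = j
  · subst h
    simp [projGen]
  · simp [projGen, h]

@[simp] theorem idem_smul_projGen (j : J) :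
    op (C.idem (lam j)) • C.projGen lam j = C.projGen lam j := by
  ext i
  change (C.projGen lam j).1 i * C.idem (lam j) = _
  rw [projGen_val]
  split_ifs with h
  · rw [h, idem_mul_self]
  · rw [zero_mul]

variable [Fintype J]

theorem proj_eq_sum (g : C.proj lam) : g = ∑ j, op (g.1 j) • C.projGen lam j := by
  ext i
  rw [AddSubmonoidClass.coe_finsetSum, Finset.sum_apply]
  have (j : J) : (op (g.1 j) • C.projGen lam j).1 i = if i = j then g.1 i else 0 := by
    change (C.projGen lam j).1 i * g.1 j = _
    rw [projGen_val]
    split_ifs with h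
    · rw [← h, proj_apply]
    · rw [zero_mul]
  change _ = ∑ j, (op (g.1 j) • C.projGen lam j).1 i
  simp [this]

section

variable {Y : Type*} [AddCommGroup Y] [Module C.Algᵐᵒᵖ Y]

variable {lam} in
theorem proj_hom_ext {f g : C.proj lam →ₗ[C.Algᵐᵒᵖ] Y}
    (h : ∀ j, f (C.projGen lam j) = g (C.projGen lam j)) : f = g := by
  ext x
  rw [proj_eq_sum C lam x]
  simp [h]

omit [DecidableEq J]

/-- The map `∏_j e_{lam j} A → Y` with `e_{lam j} ↦ y j · e_{lam j}`. -/
def projDesc (y : J → Y) : C.proj lam →ₗ[C.Algᵐᵒᵖ] Y where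
  toFun g := ∑ j, op (g.1 j) • y j
  map_add' g h := by
    rw [← Finset.sum_add_distrib]
    refine Finset.sum_congr rfl fun j _ => ?_
    rw [← add_smul]
    rfl
  map_smul' a g := by
    rw [Finset.smul_sum]
    refine Finset.sum_congr rfl fun j _ => ?_
    rw [RingHom.id_apply, ← mul_smul]
    rfl

theorem projDesc_apply (y : J → Y) (g : C.proj lam) :
    C.projDesc lam y g = ∑ j, op (g.1 j) • y j := rfl

end

@[simp] theorem projDesc_projGen {Y : Type*} [AddCommGroup Y] [Module C.Algᵐᵒᵖ Y] (y : J → Y)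
    (j : J) : C.projDesc lam y (C.projGen lam j) = op (C.idem (lam j)) • y j := by
  rw [projDesc_apply, Finset.sum_eq_single j]
  · rw [projGen_val, if_pos rfl]
  · intro i _ h
    rw [projGen_val, if_neg h, op_zero, zero_smul]
  · simp

instance projective_proj : Projective (ModuleCat.of C.Algᵐᵒᵖ (C.proj lam)) where
  factors {E X} f e he := by
    have hsurj := (ModuleCat.epi_iff_surjective e).1 he
    choose y hy using fun j => hsurj (f.hom (C.projGen lam j))
    refine ⟨ModuleCat.ofHom (C.projDesc lam y), ModuleCat.hom_ext (C.proj_hom_ext fun j => ?_)⟩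
    change e.hom (C.projDesc lam y (C.projGen lam j)) = f.hom (C.projGen lam j)
    rw [projDesc_projGen, map_smul, hy, ← map_smul, idem_smul_projGen]

/-- `Hom(∏_j e_{lam j} A, Y) = ∏_j Y e_{lam j}`. -/
def projHomEquiv (Y : C.RMod) :
    (ModuleCat.of C.Algᵐᵒᵖ (C.proj lam) ⟶ Y) ≃ₗ[k] ∀ j, C.vertexSpace Y (lam j) where
  toFun f j := ⟨f.hom (C.projGen lam j), by
    change op _ • _ = _
    rw [← map_smul, idem_smul_projGen]⟩
  map_add' f g := rfl
  map_smul' c f := rfl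
  invFun y := ModuleCat.ofHom (C.projDesc lam fun j => (y j).1)
  left_inv f := ModuleCat.hom_ext (C.proj_hom_ext fun j => by
    rw [ModuleCat.hom_ofHom, projDesc_projGen]
    rw [← map_smul, idem_smul_projGen])
  right_inv y := by
    ext j
    exact (C.projDesc_projGen lam _ j).trans (y j).2

end Proj

/-! ### The standard resolution -/

section Resolution

variable {X : Type*} [AddCommGroup X] [Module k X] [Module C.Algᵐᵒᵖ X]
  [IsScalarTower k C.Algᵐᵒᵖ X] {J : Type} (lam : J → Vertex C.p) (b : Module.Basis J k X)

/-- The basis `b` of a right module is compatible with the decomposition of the module by the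
vertices: `b j` lies in the space of the vertex `lam j`. -/
def IsVertexBasis : Prop := ∀ j, op (C.idem (lam j)) • b j = b j

variable {C lam b} in
theorem IsVertexBasis.idem_smul (hb : C.IsVertexBasis lam b) (v : Vertex C.p) (j : J) :
    op (C.idem v) • b j = if lam j = v then b j else 0 := by
  rw [← hb j, ← mul_smul, ← op_mul, idem_mul_idem]
  split_ifs with h
  · rfl
  · simp

variable {C lam b} in
theorem IsVertexBasis.repr_idem_smul (hb : C.IsVertexBasis lam b) (v : Vertex C.p) (x : X)
    (j : J) : b.repr (op (C.idem v) • x) j = if lam j = v then b.repr x j else 0 := by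
  classical
  have : b.coord j ∘ₗ Algebra.lsmul k k X (op (C.idem v)) =
      if lam j = v then b.coord j else 0 := by
    refine b.ext fun i => ?_
    simp only [LinearMap.comp_apply, Algebra.lsmul_coe, hb.idem_smul]
    by_cases hij : i = j
    · subst hij
      split_ifs <;> simp
    · split_ifs <;> simp [hij]
  have h := LinearMap.congr_fun this x
  simp only [LinearMap.comp_apply, Algebra.lsmul_coe, Module.Basis.coord_apply] at h
  rw [h]
  split_ifs <;> rfl

/-- The element `x ⊗ a` of `∏_j e_{lam j} A`, considered as the tensor product of `X` and `A` over
the algebra spanned by the idempotents of the vertices. -/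
def resTmul : X →ₗ[k] C.Alg →ₗ[k] C.proj lam :=
  LinearMap.mk₂ k
    (fun x a => ⟨fun j => b.repr x j • (C.idem (lam j) * a), fun j => by
      rw [mul_smul_comm, ← mul_assoc, idem_mul_self]⟩)
    (fun x y a => by
      ext j
      change b.repr (x + y) j • (C.idem (lam j) * a) =
        b.repr x j • (C.idem (lam j) * a) + b.repr y j • (C.idem (lam j) * a)
      rw [map_add, Finsupp.add_apply, add_smul])
    (fun c x a => by
      ext j
      change b.repr (c • x) j • (C.idem (lam j) * a) = c • (b.repr x j • (C.idem (lam j) * a))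
      rw [map_smul, Finsupp.smul_apply, smul_assoc])
    (fun x a a' => by
      ext j
      change b.repr x j • (C.idem (lam j) * (a + a')) =
        b.repr x j • (C.idem (lam j) * a) + b.repr x j • (C.idem (lam j) * a')
      rw [mul_add, smul_add])
    (fun c x a => by
      ext j
      change b.repr x j • (C.idem (lam j) * c • a) = c • (b.repr x j • (C.idem (lam j) * a))
      rw [mul_smul_comm, smul_comm])

theorem resTmul_val (x : X) (a : C.Alg) (j : J) :
    (C.resTmul lam b x a).1 j = b.repr x j • (C.idem (lam j) * a) := rfl

theorem smul_resTmul (x : X) (a c : C.Alg) :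
    op c • C.resTmul lam b x a = C.resTmul lam b x (a * c) := by
  ext j
  change (C.resTmul lam b x a).1 j * c = _
  simp [resTmul_val, mul_assoc]

variable {C lam b} in
theorem resTmul_idem_smul (hb : C.IsVertexBasis lam b) (v : Vertex C.p) (x : X) (a : C.Alg) :
    C.resTmul lam b (op (C.idem v) • x) a = C.resTmul lam b x (C.idem v * a) := by
  ext j
  rw [resTmul_val, resTmul_val, hb.repr_idem_smul, ← mul_assoc, idem_mul_idem]
  split_ifs <;> simp

/-- The generators of the term of degree one: the pairs of an arrow and an element of the basis at
the source of the arrow. -/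
abbrev ArrowIndex : Type := {x : Arrow C.p × J // source x.1 = lam x.2}

/-- The generators of the term of degree two: the pairs of a canonical relation and an element of
the basis at the vertex `0`. -/
abbrev RelIndex : Type := {x : Fin C.n × J // 2 ≤ x.1.val ∧ lam x.2 = Vertex.zero}

/-- The vertex of a generator of degree one: the target of its arrow. -/
abbrev arrowVertex (x : C.ArrowIndex lam) : Vertex C.p := target x.1.1

/-- The vertex of the generators of degree two: all canonical relations end at `c`. -/
abbrev relVertex (_ : C.RelIndex lam) : Vertex C.p := Vertex.c

/-- The linear map `x ↦ x ⊗ α ⊗ 1` to the term of degree one. -/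
def arrowTmul (α : Arrow C.p) : X →ₗ[k] C.proj (C.arrowVertex lam) where
  toFun x := ⟨fun z => if z.1.1 = α then b.repr x z.1.2 • C.idem (target z.1.1) else 0, fun z => by
    dsimp only
    split_ifs
    · rw [mul_smul_comm, idem_mul_self]
    · rw [mul_zero]⟩
  map_add' x y := by
    ext z
    change _ = (ite _ _ _ : C.Alg) + ite _ _ _
    simp only [map_add, Finsupp.add_apply]
    split_ifs
    · rw [add_smul]
    · rw [add_zero]
  map_smul' c x := by
    ext z
    change _ = c • (ite _ _ _ : C.Alg)
    simp only [map_smul, Finsupp.smul_apply, smul_ite, smul_zero, smul_assoc]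

theorem arrowTmul_val (α : Arrow C.p) (x : X) (z : C.ArrowIndex lam) :
    (C.arrowTmul lam b α x).1 z =
      if z.1.1 = α then b.repr x z.1.2 • C.idem (target z.1.1) else 0 := rfl

theorem idem_smul_arrowTmul (α : Arrow C.p) (x : X) :
    op (C.idem (target α)) • C.arrowTmul lam b α x = C.arrowTmul lam b α x := by
  ext z
  change (C.arrowTmul lam b α x).1 z * C.idem (target α) = _
  rw [arrowTmul_val]
  split_ifs with h
  · rw [h, smul_mul_assoc, idem_mul_self]
  · rw [zero_mul]

variable {C lam b} in
theorem arrowTmul_idem_smul (hb : C.IsVertexBasis lam b) (α : Arrow C.p) (x : X) :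
    C.arrowTmul lam b α (op (C.idem (source α)) • x) = C.arrowTmul lam b α x := by
  ext z
  rw [arrowTmul_val, arrowTmul_val]
  split_ifs with h
  · rw [hb.repr_idem_smul, if_pos]
    rw [← h, z.2]
  · rfl

/-- The image of the generator of degree two of a canonical relation: the derivative of the
relation. -/
def relImage (i : Fin C.n) (x : X) : C.proj (C.arrowVertex lam) :=
  C.leibniz (C.arrowTmul lam b) (C.armList i) x -
    (C.leibniz (C.arrowTmul lam b) (C.armList C.arm0) x +
      C.lam i • C.leibniz (C.arrowTmul lam b) (C.armList C.arm1) x)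

variable [Fintype J]

/-- The augmentation `∏_j e_{lam j} A → X`. -/
def resAug : C.proj lam →ₗ[C.Algᵐᵒᵖ] X := C.projDesc lam b

/-- The differential from degree one to degree zero. -/
def resD₁ : C.proj (C.arrowVertex lam) →ₗ[C.Algᵐᵒᵖ] C.proj lam :=
  C.projDesc (C.arrowVertex lam) fun z =>
    C.resTmul lam b (b z.1.2) (C.arr z.1.1) - C.resTmul lam b (op (C.arr z.1.1) • b z.1.2) 1

/-- The differential from degree two to degree one. -/
def resD₂ : C.proj (C.relVertex lam) →ₗ[C.Algᵐᵒᵖ] C.proj (C.arrowVertex lam) :=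
  C.projDesc (C.relVertex lam) fun z => C.relImage lam b z.1.1 (b z.1.2)

section Exactness

variable {C lam b} (hb : C.IsVertexBasis lam b)
include hb

theorem resAug_resTmul (x : X) (a : C.Alg) : C.resAug lam b (C.resTmul lam b x a) = op a • x := by
  rw [resAug, projDesc_apply]
  simp only [resTmul_val, op_smul, op_mul, smul_assoc, mul_smul, hb _]
  conv_rhs => rw [← b.sum_repr x, Finset.smul_sum]
  refine Finset.sum_congr rfl fun j _ => ?_
  rw [smul_algebra_smul_comm]

theorem surjective_resAug : Function.Surjective (C.resAug lam b) := fun x =>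
  ⟨C.resTmul lam b x 1, by rw [resAug_resTmul hb, op_one, one_smul]⟩

theorem eq_sum_resTmul (g : C.proj lam) : g = ∑ j, C.resTmul lam b (b j) (g.1 j) := by
  classical
  conv_lhs => rw [C.proj_eq_sum lam g]
  refine Finset.sum_congr rfl fun j _ => ?_
  ext i
  change (C.projGen lam j).1 i * g.1 j = _
  rw [projGen_val, resTmul_val, Module.Basis.repr_self, Finsupp.single_apply]
  by_cases h : i = j
  · simp [h]
  · simp [h, Ne.symm h]

theorem arrowTmul_basis [DecidableEq J] (z : C.ArrowIndex lam) :
    C.arrowTmul lam b z.1.1 (b z.1.2) = C.projGen (C.arrowVertex lam) z := by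
  ext y
  rw [arrowTmul_val, projGen_val, Module.Basis.repr_self, Finsupp.single_apply]
  by_cases h : y = z
  · simp [h]
  · rw [if_neg h]
    split_ifs with h1 h2
    · exact absurd (Subtype.ext (Prod.ext h1 h2.symm)) h
    · rw [zero_smul]
    · rfl

theorem resD₁_projGen [DecidableEq J] (z : C.ArrowIndex lam) :
    C.resD₁ lam b (C.projGen (C.arrowVertex lam) z) =
      C.resTmul lam b (b z.1.2) (C.arr z.1.1) -
        C.resTmul lam b (op (C.arr z.1.1) • b z.1.2) 1 := by
  rw [resD₁, projDesc_projGen, smul_sub, smul_resTmul, smul_resTmul, arr_mul_target, one_mul]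
  congr 1
  nth_rw 2 [← arr_mul_target]
  rw [op_mul, mul_smul, resTmul_idem_smul hb, mul_one]

theorem resD₁_arrowTmul (α : Arrow C.p) (x : X) :
    C.resD₁ lam b (C.arrowTmul lam b α x) =
      C.resTmul lam b x (C.arr α) - C.resTmul lam b (op (C.arr α) • x) 1 := by
  classical
  have : (C.resD₁ lam b).restrictScalars k ∘ₗ C.arrowTmul lam b α =
      (C.resTmul lam b).flip (C.arr α) -
        (C.resTmul lam b).flip 1 ∘ₗ Algebra.lsmul k k X (op (C.arr α)) := by
    refine b.ext fun j => ?_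
    change C.resD₁ lam b (C.arrowTmul lam b α (b j)) =
      C.resTmul lam b (b j) (C.arr α) - C.resTmul lam b (op (C.arr α) • b j) 1
    by_cases h : source α = lam j
    · exact (congrArg _ (arrowTmul_basis hb ⟨(α, j), h⟩)).trans (resD₁_projGen hb ⟨(α, j), h⟩)
    · have h0 : op (C.idem (source α)) • b j = 0 := by
        rw [hb.idem_smul, if_neg (Ne.symm h)]
      rw [← arrowTmul_idem_smul hb, ← source_mul_arr, ← resTmul_idem_smul hb, op_mul, mul_smul, h0]
      simp
  exact LinearMap.congr_fun this x

theorem resD₁_leibniz (l : List (Arrow C.p)) (x : X) :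
    C.resD₁ lam b (C.leibniz (C.arrowTmul lam b) l x) =
      C.resTmul lam b x (C.pathProd l) - C.resTmul lam b (op (C.pathProd l) • x) 1 := by
  induction l generalizing x with
  | nil => simp
  | cons α l ih =>
    rw [leibniz_cons, map_add, map_smul, resD₁_arrowTmul hb, ih, smul_sub, smul_resTmul,
      smul_resTmul, pathProd_cons, one_mul, op_mul, mul_smul, sub_add_sub_cancel]

theorem resD₁_relImage {i : Fin C.n} (hi : 2 ≤ i.val) (x : X) :
    C.resD₁ lam b (C.relImage lam b i x) = 0 := by
  rw [relImage, map_sub, map_add, LinearMap.map_smul_of_tower, resD₁_leibniz hb, resD₁_leibniz hb,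
    resD₁_leibniz hb, C.pathProd_armList i hi]
  simp only [map_add, map_smul, op_smul, add_smul, smul_assoc, LinearMap.add_apply,
    LinearMap.smul_apply, MulOpposite.op_add, smul_sub]
  abel

theorem resD₁_comp_resD₂ : C.resD₁ lam b ∘ₗ C.resD₂ lam b = 0 := by
  classical
  refine C.proj_hom_ext fun z => ?_
  rw [LinearMap.comp_apply, resD₂, projDesc_projGen, map_smul, resD₁_relImage hb z.2.1, smul_zero,
    LinearMap.zero_apply]

theorem resAug_comp_resD₁ : C.resAug lam b ∘ₗ C.resD₁ lam b = 0 := by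
  classical
  refine C.proj_hom_ext fun z => ?_
  rw [LinearMap.comp_apply, resD₁_projGen hb, map_sub, resAug_resTmul hb, resAug_resTmul hb,
    op_one, one_smul, sub_self, LinearMap.zero_apply]

/-- Modulo boundaries, `x ⊗ a` equals `x a ⊗ 1`. -/
theorem resTmul_sub_mem_range (a : C.Alg) (x : X) :
    C.resTmul lam b x a - C.resTmul lam b (op a • x) 1 ∈ LinearMap.range (C.resD₁ lam b) := by
  induction a using alg_induction generalizing x with
  | algebraMap c =>
    rw [Algebra.algebraMap_eq_smul_one, op_smul, op_one, smul_assoc, one_smul]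
    simp
  | idem v =>
    rw [resTmul_idem_smul hb, mul_one, sub_self]
    exact zero_mem _
  | arr α => exact ⟨_, resD₁_arrowTmul hb α x⟩
  | mul a c ha hc =>
    have := add_mem (Submodule.smul_mem _ (op c) (ha x)) (hc (op a • x))
    rwa [smul_sub, smul_resTmul, smul_resTmul, one_mul, sub_add_sub_cancel, ← mul_smul,
      ← op_mul] at this
  | add a c ha hc =>
    have := add_mem (ha x) (hc x)
    rw [MulOpposite.op_add, add_smul]
    simp only [map_add, LinearMap.add_apply]
    convert this using 1
    abel

theorem exact_resD₁_resAug : Function.Exact (C.resD₁ lam b) (C.resAug lam b) := by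
  intro g
  refine ⟨fun hg => ?_, ?_⟩
  · have h1 : g = ∑ j, (C.resTmul lam b (b j) (g.1 j) -
        C.resTmul lam b (op (g.1 j) • b j) 1) := by
      have h2 : ∑ j, C.resTmul lam b (op (g.1 j) • b j) 1 = 0 := by
        rw [← LinearMap.sum_apply, ← map_sum]
        change C.resTmul lam b (C.resAug lam b g) 1 = 0
        rw [hg]
        simp
      rw [Finset.sum_sub_distrib, h2, sub_zero]
      exact eq_sum_resTmul hb g
    rw [h1]
    exact sum_mem (S := LinearMap.range (C.resD₁ lam b)) fun j _ => resTmul_sub_mem_range hb _ _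
  · rintro ⟨y, rfl⟩
    exact LinearMap.congr_fun (resAug_comp_resD₁ hb) y

theorem leibniz_comp {Y Z : Type*} [AddCommGroup Y] [Module k Y] [Module C.Algᵐᵒᵖ Y]
    [IsScalarTower k C.Algᵐᵒᵖ Y] [AddCommGroup Z] [Module k Z] [Module C.Algᵐᵒᵖ Z]
    [IsScalarTower k C.Algᵐᵒᵖ Z] (ξ : Arrow C.p → X →ₗ[k] Y) (f : Y →ₗ[C.Algᵐᵒᵖ] Z)
    (l : List (Arrow C.p)) :
    C.leibniz (fun α => f.restrictScalars k ∘ₗ ξ α) l = f.restrictScalars k ∘ₗ C.leibniz ξ l := by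
  ext x
  induction l generalizing x with
  | nil => simp
  | cons α l ih =>
    rw [leibniz_cons, ih, LinearMap.comp_apply, LinearMap.comp_apply, LinearMap.comp_apply,
      leibniz_cons, map_add]
    simp

theorem relImage_mem_range {i : Fin C.n} (hi : 2 ≤ i.val) (x : X) :
    C.relImage lam b i x ∈ LinearMap.range (C.resD₂ lam b) := by
  classical
  have hs := arrowTmul_idem_smul hb
  have ht := C.idem_smul_arrowTmul lam b
  rw [← b.sum_repr x]
  have hlin (y : X) : C.relImage lam b i y = (C.leibniz (C.arrowTmul lam b) (C.armList i) -
      (C.leibniz (C.arrowTmul lam b) (C.armList C.arm0) +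
        C.lam i • C.leibniz (C.arrowTmul lam b) (C.armList C.arm1))) y := rfl
  rw [hlin, map_sum]
  refine sum_mem (S := LinearMap.range (C.resD₂ lam b)) fun j _ => ?_
  rw [map_smul, ← hlin]
  refine Submodule.smul_of_tower_mem _ _ ?_
  by_cases hj : lam j = Vertex.zero
  · refine ⟨C.projGen (C.relVertex lam) ⟨(i, j), hi, hj⟩, ?_⟩
    rw [resD₂, projDesc_projGen]
    simp only [relImage, smul_sub, smul_add]
    have hc (c : k) (y : C.proj (C.arrowVertex lam)) (a : C.Alg) : op a • c • y = c • op a • y :=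
      Subtype.ext (funext fun z => smul_mul_assoc c (y.1 z) a)
    simp only [hc, C.idem_c_leibniz_armList ht]
  · have h0 : op (C.idem Vertex.zero) • b j = 0 := by rw [hb.idem_smul, if_neg hj]
    have h1 : ∀ i', C.leibniz (C.arrowTmul lam b) (C.armList i') (b j) = 0 := fun i' => by
      rw [← C.leibniz_armList_idem_zero hs, h0, map_zero]
    simp [relImage, h1]

theorem exact_resD₂_resD₁ : Function.Exact (C.resD₂ lam b) (C.resD₁ lam b) := by
  classical
  intro g
  refine ⟨fun hg => ?_, ?_⟩
  · let π := (LinearMap.range (C.resD₂ lam b)).mkQ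
    let ξ : Arrow C.p → X →ₗ[k] (C.proj (C.arrowVertex lam) ⧸ LinearMap.range (C.resD₂ lam b)) :=
      fun α => π.restrictScalars k ∘ₗ C.arrowTmul lam b α
    have hξ (α) (x) : ξ α x = π (C.arrowTmul lam b α x) := rfl
    obtain ⟨D, hD, hD0, hD1⟩ := C.exists_derivation ξ
      (fun α x => by rw [hξ, hξ, arrowTmul_idem_smul hb])
      (fun α x => by rw [hξ, ← map_smul, idem_smul_arrowTmul])
      (fun i hi => by
        simp only [ξ, leibniz_comp hb]
        ext x
        have h := (Submodule.Quotient.mk_eq_zero _).2 (relImage_mem_range hb hi x)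
        change π _ = 0 at h
        rw [relImage, map_sub, sub_eq_zero, map_add, LinearMap.map_smul_of_tower] at h
        exact h)
    -- The derivation of the extension of `X` by the cokernel induces a left inverse, up to the
    -- projection `π`, of the differential.
    let Φ : C.proj lam → (C.proj (C.arrowVertex lam) ⧸ LinearMap.range (C.resD₂ lam b)) :=
      fun g => ∑ j, D (g.1 j) (b j)
    have hΦadd (g h) : Φ (g + h) = Φ g + Φ h := by
      simp only [Φ, ← Finset.sum_add_distrib]
      refine Finset.sum_congr rfl fun j _ => ?_
      change D (g.1 j + h.1 j) (b j) = _
      rw [map_add, LinearMap.add_apply]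
    let Φ' := AddMonoidHom.mk' Φ hΦadd
    have hΦ (x : X) (a : C.Alg) : Φ' (C.resTmul lam b x a) = D a x := by
      change ∑ j, D (b.repr x j • (C.idem (lam j) * a)) (b j) = _
      conv_rhs => rw [← b.sum_repr x, map_sum]
      refine Finset.sum_congr rfl fun j _ => ?_
      rw [map_smul, map_smul, LinearMap.smul_apply, hD, hD0, hb j]
      simp
    have hg' : π g = Φ' (C.resD₁ lam b g) := by
      rw [resD₁, projDesc_apply, map_sum]
      conv_lhs => rw [C.proj_eq_sum _ g, map_sum]
      refine Finset.sum_congr rfl fun z _ => ?_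
      rw [smul_sub, smul_resTmul, smul_resTmul, one_mul, map_sub, hΦ, hΦ, hD, add_sub_cancel_right,
        hD1, map_smul, hξ, arrowTmul_basis hb]
    rw [hg, map_zero] at hg'
    exact (Submodule.Quotient.mk_eq_zero _).1 hg'
  · rintro ⟨y, rfl⟩
    exact LinearMap.congr_fun (resD₁_comp_resD₂ hb) y

/-- The derivative of a path has components only at the arrows of the path. -/
theorem leibniz_arrowTmul_eq_zero {l : List (Arrow C.p)} {z : C.ArrowIndex lam} (h : z.1.1 ∉ l)
    (x : X) : (C.leibniz (C.arrowTmul lam b) l x).1 z = 0 := by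
  induction l generalizing x with
  | nil => rfl
  | cons α l ih =>
    rw [List.mem_cons, not_or] at h
    rw [leibniz_cons]
    change (C.arrowTmul lam b α x).1 z * C.pathProd l +
      (C.leibniz (C.arrowTmul lam b) l (op (C.arr α) • x)).1 z = 0
    rw [arrowTmul_val, if_neg h.1, zero_mul, zero_add]
    exact ih h.2 _

theorem injective_resD₂ : Function.Injective (C.resD₂ lam b) := by
  classical
  rw [injective_iff_map_eq_zero]
  intro g hg
  ext z
  obtain ⟨⟨i, j⟩, hi, hj⟩ := z
  change g.1 _ = 0
  -- The component at the first arrow of the arm `i` only sees the relation of the arm `i`.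
  let z₁ : C.ArrowIndex lam := ⟨(C.firstArrow i, j), hj.symm⟩
  have hother (i') (h : i' ≠ i) (x : X) :
      (C.leibniz (C.arrowTmul lam b) (C.armList i') x).1 z₁ = 0 :=
    leibniz_arrowTmul_eq_zero hb (fun hm => h (C.mem_armList hm).symm) x
  have hself (x : X) : (C.leibniz (C.arrowTmul lam b) (C.armList i) x).1 z₁ =
      b.repr x j • (C.idem (vertexAt C.p i 1) * C.pathProd ((C.armList i).drop 1)) := by
    have h0 := leibniz_arrowTmul_eq_zero hb (z := z₁) (C.firstArrow_notMem_drop i)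
      (op (C.arr (C.firstArrow i)) • x)
    conv_lhs => rw [armList_eq_cons, leibniz_cons]
    change (C.arrowTmul lam b (C.firstArrow i) x).1 z₁ * C.pathProd ((C.armList i).drop 1) +
      (C.leibniz (C.arrowTmul lam b) ((C.armList i).drop 1)
        (op (C.arr (C.firstArrow i)) • x)).1 z₁ = _
    refine (congrArg _ h0).trans ?_
    rw [add_zero, arrowTmul_val, if_pos rfl, smul_mul_assoc]
    rfl
  have h0 : C.arm0 ≠ i := fun h => by simp [← h, arm0] at hi
  have h1 : C.arm1 ≠ i := fun h => by simp [← h, arm1] at hi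
  have hval (z : C.RelIndex lam) : (C.relImage lam b z.1.1 (b z.1.2)).1 z₁ =
      if z = ⟨(i, j), hi, hj⟩ then
        C.idem (vertexAt C.p i 1) * C.pathProd ((C.armList i).drop 1) else 0 := by
    change (C.leibniz (C.arrowTmul lam b) (C.armList z.1.1) (b z.1.2)).1 z₁ -
      ((C.leibniz (C.arrowTmul lam b) (C.armList C.arm0) (b z.1.2)).1 z₁ +
        C.lam z.1.1 • (C.leibniz (C.arrowTmul lam b) (C.armList C.arm1) (b z.1.2)).1 z₁) = _
    rw [hother _ h0, hother _ h1, smul_zero, add_zero, sub_zero]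
    split_ifs with h
    · subst h
      rw [hself]
      simp
    · by_cases hzi : z.1.1 = i
      · rw [hzi, hself, Module.Basis.repr_self, Finsupp.single_eq_of_ne, zero_smul]
        exact fun hzj => h (Subtype.ext (Prod.ext hzi hzj.symm))
      · rw [hother _ hzi]
  have h2 : (C.resD₂ lam b g).1 z₁ =
      ∑ z, (C.relImage lam b z.1.1 (b z.1.2)).1 z₁ * g.1 z := by
    rw [resD₂, projDesc_apply, AddSubmonoidClass.coe_finsetSum, Finset.sum_apply]
    rfl
  rw [hg] at h2
  simp only [hval, ite_mul, zero_mul, Finset.sum_ite_eq', Finset.mem_univ, if_true] at h2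
  rw [← C.proj_apply]
  refine C.idem_c_mul_eq_zero one_ne_zero (C.one_le i) ?_
  rw [← mul_assoc, ← h2]
  rfl

end Exactness

end Resolution

/-! ### Euler characteristics -/

section EulerChar

variable {A : Type u} [Ring A] [Algebra k A]

/-- The spaces `Ext^i(X, Y)` are finite dimensional, and zero for large `i`. -/
def ExtFinite (k : Type u) [Field k] {A : Type u} [Ring A] [Algebra k A]
    (X Y : ModuleCat.{u} Aᵐᵒᵖ) : Prop :=
  (∀ i : ℕ, Module.Finite k (Ext X Y i)) ∧ ∃ m : ℕ, ∀ i : ℕ, m ≤ i → Subsingleton (Ext X Y i)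

theorem eulerChar_eq_sum_range {X Y : ModuleCat.{u} Aᵐᵒᵖ} {m : ℕ}
    (h : ∀ i, m ≤ i → Subsingleton (Ext X Y i)) :
    eulerChar k X Y = ∑ i ∈ Finset.range m, (-1 : ℤ) ^ i * (Module.finrank k (Ext X Y i) : ℤ) := by
  refine finsum_eq_sum_of_support_subset _ fun i hi => ?_
  by_contra hm
  have := h i (by simpa using hm)
  exact hi (by simp [Module.finrank_zero_of_subsingleton])

theorem extFinite_of_projective (P Y : ModuleCat.{u} Aᵐᵒᵖ) [Projective P]
    [Module.Finite k (P ⟶ Y)] :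
    ExtFinite k P Y ∧ eulerChar k P Y = Module.finrank k (P ⟶ Y) := by
  have h (i : ℕ) (hi : 1 ≤ i) : Subsingleton (Ext P Y i) := by
    obtain ⟨i, rfl⟩ := Nat.exists_eq_add_of_le' hi
    exact Ext.subsingleton_of_projective P Y i
  refine ⟨⟨fun i => ?_, 1, h⟩, ?_⟩
  · rcases i with _ | i
    · exact Module.Finite.equiv (Ext.linearEquiv₀ (R := k)).symm
    · have := h (i + 1) (by omega)
      infer_instance
  · rw [eulerChar_eq_sum_range h, Finset.sum_range_one, pow_zero, one_mul,
      (Ext.linearEquiv₀ (R := k)).finrank_eq]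

/-- For a short exact sequence `0 → K → P → X → 0` with `P` projective, the Euler characteristic
of `X` is the difference of those of `P` and `K`. -/
theorem extFinite_of_shortExact {S : ShortComplex (ModuleCat.{u} Aᵐᵒᵖ)} (hS : S.ShortExact)
    [Projective S.X₂] (Y : ModuleCat.{u} Aᵐᵒᵖ) [Module.Finite k (S.X₂ ⟶ Y)]
    (h₁ : ExtFinite k S.X₁ Y) :
    ExtFinite k S.X₃ Y ∧
      eulerChar k S.X₃ Y = Module.finrank k (S.X₂ ⟶ Y) - eulerChar k S.X₁ Y := by
  obtain ⟨hfin, m, hm⟩ := h₁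
  have hfin₂ : Module.Finite k (Ext S.X₂ Y 0) :=
    Module.Finite.equiv (Ext.linearEquiv₀ (R := k)).symm
  let g₀ : Ext S.X₃ Y 0 →ₗ[k] Ext S.X₂ Y 0 :=
    (Ext.mk₀ S.g).precompOfLinear k Y (zero_add 0)
  let f₀ : Ext S.X₂ Y 0 →ₗ[k] Ext S.X₁ Y 0 :=
    (Ext.mk₀ S.f).precompOfLinear k Y (zero_add 0)
  let δ (i : ℕ) : Ext S.X₁ Y i →ₗ[k] Ext S.X₃ Y (i + 1) :=
    hS.extClass.precompOfLinear k Y (Nat.add_comm 1 i)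
  have hproj (i : ℕ) (x : Ext S.X₂ Y (i + 1)) : x = 0 := Ext.eq_zero_of_projective x
  have hg₀ : Function.Injective g₀ := by
    have := hS.epi_g
    exact Ext.precomp_mk₀_injective_of_epi Y S.g
  have hexact₂ : LinearMap.ker f₀ = LinearMap.range g₀ := by
    refine le_antisymm (fun x hx => ?_) ?_
    · obtain ⟨y, hy⟩ := Ext.contravariant_sequence_exact₂ hS Y x hx
      exact ⟨y, hy⟩
    · rintro _ ⟨y, rfl⟩
      change (Ext.mk₀ S.f).comp ((Ext.mk₀ S.g).comp y (zero_add 0)) (zero_add 0) = 0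
      rw [Ext.mk₀_comp_mk₀_assoc, S.zero, Ext.mk₀_zero, Ext.zero_comp]
  have hexact₁ : LinearMap.ker (δ 0) = LinearMap.range f₀ := by
    refine le_antisymm (fun x hx => ?_) ?_
    · obtain ⟨y, hy⟩ := Ext.contravariant_sequence_exact₁ hS Y x (Nat.add_comm 1 0) hx
      exact ⟨y, hy⟩
    · rintro _ ⟨y, rfl⟩
      change hS.extClass.comp ((Ext.mk₀ S.f).comp y (zero_add 0)) (Nat.add_comm 1 0) = 0
      rw [← Ext.comp_assoc _ _ _ (add_zero 1) (zero_add 0) (by omega), hS.extClass_comp,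
        Ext.zero_comp]
  have hδ_surj (i : ℕ) : Function.Surjective (δ i) := fun x => by
    obtain ⟨y, hy⟩ := Ext.contravariant_sequence_exact₃ hS Y x (hproj i _) (Nat.add_comm 1 i)
    exact ⟨y, hy⟩
  have hδ_inj (i : ℕ) : Function.Injective (δ (i + 1)) := by
    rw [injective_iff_map_eq_zero]
    intro x hx
    obtain ⟨y, hy⟩ := Ext.contravariant_sequence_exact₁ hS Y x (Nat.add_comm 1 (i + 1)) hx
    rw [← hy, hproj i y, Ext.comp_zero]
  have hfin₃ : ∀ i, Module.Finite k (Ext S.X₃ Y i)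
    | 0 => Module.Finite.of_injective g₀ hg₀
    | i + 1 => Module.Finite.of_surjective (δ i) (hδ_surj i)
  have hm₃ (i : ℕ) (hi : m + 2 ≤ i) : Subsingleton (Ext S.X₃ Y i) := by
    obtain ⟨i, rfl⟩ := Nat.exists_eq_add_of_le' (show 1 ≤ i by omega)
    have := hm i (by omega)
    exact (hδ_surj i).subsingleton
  refine ⟨⟨hfin₃, m + 2, hm₃⟩, ?_⟩
  have e₁ := LinearMap.finrank_range_add_finrank_ker f₀
  have e₂ := LinearMap.finrank_range_add_finrank_ker (δ 0)
  rw [hexact₂, LinearMap.finrank_range_of_inj hg₀] at e₁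
  rw [hexact₁, LinearMap.range_eq_top.2 (hδ_surj 0), finrank_top] at e₂
  have e₃ (i : ℕ) : Module.finrank k (Ext S.X₃ Y (i + 1 + 1)) =
      Module.finrank k (Ext S.X₁ Y (i + 1)) :=
    (LinearEquiv.ofBijective (δ (i + 1)) ⟨hδ_inj i, hδ_surj (i + 1)⟩).finrank_eq.symm
  rw [eulerChar_eq_sum_range hm₃, eulerChar_eq_sum_range (m := m + 1) fun i hi => hm i (by omega),
    Finset.sum_range_succ', Finset.sum_range_succ', Finset.sum_range_succ']
  simp only [e₃, pow_succ, pow_zero, mul_neg, mul_one, neg_mul, neg_neg, one_mul,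
    Finset.sum_neg_distrib, zero_add]
  rw [(Ext.linearEquiv₀ (R := k) (X := S.X₂) (Y := Y)).finrank_eq] at e₁
  linarith

end EulerChar

/-! ### The Euler form -/

theorem sum_idem_smul {X : Type*} [AddCommGroup X] [Module C.Algᵐᵒᵖ X] (x : X) :
    ∑ v, op (C.idem v) • x = x := by
  rw [← Finset.sum_smul, ← Finset.op_sum, sum_idem, op_one, one_smul]

theorem mem_vertexSpace {M : C.RMod} {v : Vertex C.p} {x : M} :
    x ∈ C.vertexSpace M v ↔ op (C.idem v) • x = x := Iff.rfl

/-- A right module is the direct sum of the spaces of the vertices. -/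
def vertexEquiv (X : C.RMod) : X ≃ₗ[k] ∀ v, C.vertexSpace X v where
  toFun x v := ⟨op (C.idem v) • x, by
    rw [mem_vertexSpace, ← mul_smul, ← op_mul, idem_mul_self]⟩
  map_add' x y := by
    ext v
    exact smul_add _ _ _
  map_smul' c x := by
    ext v
    exact (Algebra.lsmul k k X (op (C.idem v))).map_smul c x
  invFun y := ∑ v, (y v).1
  left_inv x := C.sum_idem_smul x
  right_inv y := by
    ext v
    change op (C.idem v) • ∑ w, (y w).1 = (y v).1
    rw [Finset.smul_sum, Finset.sum_eq_single v]
    · exact (y v).2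
    · intro w _ h
      rw [← C.mem_vertexSpace.1 (y w).2, ← mul_smul, ← op_mul, C.idem_mul_of_ne h, op_zero,
        zero_smul]
    · simp

/-- The index set of a basis of a module that is compatible with the vertices. -/
abbrev BasisIndex (X : C.RMod) : Type :=
  Σ v : Vertex C.p, Fin (Module.finrank k (C.vertexSpace X v))

/-- The vertex of an element of the basis. -/
abbrev basisVertex (X : C.RMod) (j : C.BasisIndex X) : Vertex C.p := j.1

/-- A basis of a finite dimensional module that consists of bases of the spaces of the vertices. -/
def vertexBasis (X : C.RMod) [Module.Finite k X] : Module.Basis (C.BasisIndex X) k X :=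
  (Pi.basis fun v => Module.finBasis k (C.vertexSpace X v)).map (C.vertexEquiv X).symm

theorem isVertexBasis_vertexBasis (X : C.RMod) [Module.Finite k X] :
    C.IsVertexBasis (C.basisVertex X) (C.vertexBasis X) := by
  rintro ⟨v, j⟩
  have : C.vertexBasis X ⟨v, j⟩ = (Module.finBasis k (C.vertexSpace X v) j).1 := by
    rw [vertexBasis, Module.Basis.map_apply, Pi.basis_apply]
    change ∑ w, ((Pi.single v (Module.finBasis k (C.vertexSpace X v) j) :
      ∀ w, C.vertexSpace X w) w).1 = _
    rw [Finset.sum_eq_single v]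
    · rw [Pi.single_eq_same]
    · intro w _ h
      rw [Pi.single_eq_of_ne h]
      rfl
    · simp
  rw [this]
  exact (Module.finBasis k (C.vertexSpace X v) j).2

theorem sum_basisVertex (X : C.RMod) (f : Vertex C.p → ℤ) :
    ∑ j, f (C.basisVertex X j) = ∑ v, C.dimVec X v * f v := by
  rw [Fintype.sum_sigma]
  simp [dimVec, basisVertex]

/-- The Euler form in terms of the quiver and the relations. -/
def quiverForm (x y : Vertex C.p → ℤ) : ℤ :=
  ∑ v, x v * y v - ∑ α : Arrow C.p, x (source α) * y (target α) +
    (C.n - 2) * (x Vertex.zero * y Vertex.c)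

instance finite_projHom {J : Type} [Fintype J] [DecidableEq J] (lam : J → Vertex C.p) (Y : C.RMod)
    [Module.Finite k Y] : Module.Finite k (ModuleCat.of C.Algᵐᵒᵖ (C.proj lam) ⟶ Y) :=
  Module.Finite.equiv (C.projHomEquiv lam Y).symm

theorem finrank_projHom {J : Type} [Fintype J] [DecidableEq J] (lam : J → Vertex C.p) (Y : C.RMod)
    [Module.Finite k Y] :
    (Module.finrank k (ModuleCat.of C.Algᵐᵒᵖ (C.proj lam) ⟶ Y) : ℤ) =
      ∑ j, C.dimVec Y (lam j) := by
  rw [(C.projHomEquiv lam Y).finrank_eq, Module.finrank_pi_fintype, Nat.cast_sum]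
  rfl

theorem shortExact_of_exact {A : Type u} [Ring A] {X Y Z : Type u} [AddCommGroup X] [Module A X]
    [AddCommGroup Y] [Module A Y] [AddCommGroup Z] [Module A Z] {f : X →ₗ[A] Y} {g : Y →ₗ[A] Z}
    (hf : Function.Injective f) (h : Function.Exact f g) (hg : Function.Surjective g) :
    ∃ w : ModuleCat.ofHom f ≫ ModuleCat.ofHom g = 0, (ShortComplex.mk _ _ w).ShortExact := by
  have w : ModuleCat.ofHom f ≫ ModuleCat.ofHom g = 0 :=
    ModuleCat.hom_ext (h.linearMap_comp_eq_zero)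
  exact ⟨w, ModuleCat.shortComplex_shortExact (ShortComplex.mk _ _ w) h hf hg⟩

theorem sum_fin_two_le {n : ℕ} (hn : 2 ≤ n) (c : ℤ) :
    ∑ i : Fin n, (if 2 ≤ i.val then c else 0) = (n - 2) * c := by
  obtain ⟨m, rfl⟩ := Nat.exists_eq_add_of_le' hn
  rw [Fin.sum_univ_eq_sum_range (fun i => if 2 ≤ i then c else 0), Finset.sum_range_succ',
    Finset.sum_range_succ']
  simp

theorem sum_arrowIndex (X : C.RMod) (y : Vertex C.p → ℤ) :
    ∑ z, y (C.arrowVertex (C.basisVertex X) z) =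
      ∑ α : Arrow C.p, C.dimVec X (source α) * y (target α) := by
  rw [← Finset.sum_subtype (Finset.univ.filter fun x : Arrow C.p × C.BasisIndex X =>
    source x.1 = C.basisVertex X x.2) (by simp) (fun x => y (target x.1)), Finset.sum_filter,
    Fintype.sum_prod_type]
  refine Finset.sum_congr rfl fun α _ => ?_
  rw [C.sum_basisVertex X fun v => if source α = v then y (target α) else 0]
  simp

theorem sum_relIndex (X : C.RMod) (y : Vertex C.p → ℤ) :
    ∑ z, y (C.relVertex (C.basisVertex X) z) =
      (C.n - 2) * (C.dimVec X Vertex.zero * y Vertex.c) := by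
  rw [← Finset.sum_subtype (Finset.univ.filter fun x : Fin C.n × C.BasisIndex X =>
    2 ≤ x.1.val ∧ C.basisVertex X x.2 = Vertex.zero) (by simp) (fun _ => y Vertex.c),
    Finset.sum_filter, Fintype.sum_prod_type, ← sum_fin_two_le C.two_le]
  refine Finset.sum_congr rfl fun i _ => ?_
  rw [C.sum_basisVertex X fun v => if 2 ≤ i.val ∧ v = Vertex.zero then y Vertex.c else 0]
  split_ifs with h <;> simp [h]

/-- The resolution of `X` by its arrows and relations computes the Euler characteristic. -/
theorem extFinite_and_eulerChar (X Y : C.RMod) [Module.Finite k X] [Module.Finite k Y] :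
    ExtFinite k X Y ∧ eulerChar k X Y = C.quiverForm (C.dimVec X) (C.dimVec Y) := by
  have hb := C.isVertexBasis_vertexBasis X
  set lam := C.basisVertex X
  set b := C.vertexBasis X
  obtain ⟨w₁, h₁⟩ := shortExact_of_exact (Z := LinearMap.range (C.resD₁ lam b))
    (injective_resD₂ hb) (g := (C.resD₁ lam b).rangeRestrict)
    (fun y => by
      rw [← exact_resD₂_resD₁ hb y]
      exact Subtype.ext_iff)
    (LinearMap.surjective_rangeRestrict _)
  obtain ⟨w₂, h₂⟩ := shortExact_of_exact (X := LinearMap.range (C.resD₁ lam b))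
    (f := (LinearMap.range (C.resD₁ lam b)).subtype) (g := C.resAug lam b)
    (Submodule.injective_subtype _)
    (fun y => by
      rw [exact_resD₁_resAug hb y]
      simp)
    (surjective_resAug hb)
  have i₁ := (extFinite_of_projective (k := k)
    (ModuleCat.of C.Algᵐᵒᵖ (C.proj (C.relVertex lam))) Y)
  have i₂ := extFinite_of_shortExact (k := k) h₁ Y i₁.1
  have i₃ := extFinite_of_shortExact (k := k) h₂ Y i₂.1
  refine ⟨i₃.1, i₃.2.trans ?_⟩
  rw [i₂.2, i₁.2]
  simp only
  rw [finrank_projHom, finrank_projHom, finrank_projHom]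
  rw [sum_arrowIndex, sum_relIndex, sum_basisVertex, quiverForm]
  ring

theorem smul_simple (v : Vertex C.p) (a : C.Alg) (x : C.simple v) :
    op a • x = (C.character v a * (show k from x) : k) := rfl

theorem smul_simple' (v : Vertex C.p) (c : k) (x : C.simple v) :
    c • x = (c * (show k from x) : k) := by
  rw [← algebraMap_smul C.Algᵐᵒᵖ c x, MulOpposite.algebraMap_apply, smul_simple, AlgHom.commutes]
  rfl

/-- The space underlying a simple module is the field. -/
def simpleEquiv (v : Vertex C.p) : C.simple v ≃ₗ[k] k where
  toFun x := x
  map_add' _ _ := rfl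
  map_smul' c x := C.smul_simple' v c x
  invFun x := x
  left_inv _ := rfl
  right_inv _ := rfl

instance (v : Vertex C.p) : Module.Finite k (C.simple v) :=
  Module.Finite.equiv (C.simpleEquiv v).symm

theorem dimVec_simple (v : Vertex C.p) : C.dimVec (C.simple v) = Pi.single v 1 := by
  ext w
  by_cases h : w = v
  · subst h
    have : C.vertexSpace (C.simple w) w = ⊤ := by
      rw [eq_top_iff]
      intro x _
      rw [mem_vertexSpace, smul_simple, character_idem, if_pos rfl, one_mul]
    rw [dimVec, this, finrank_top, (C.simpleEquiv w).finrank_eq, Module.finrank_self,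
      Pi.single_eq_same, Nat.cast_one]
  · have : C.vertexSpace (C.simple v) w = ⊥ := by
      rw [eq_bot_iff]
      intro x hx
      rw [mem_vertexSpace, smul_simple, character_idem, if_neg h, zero_mul] at hx
      exact hx.symm
    rw [dimVec, this, finrank_bot, Pi.single_eq_of_ne h, Nat.cast_zero]

theorem eulerForm_eq_quiverForm (x y : Vertex C.p → ℤ) : C.eulerForm x y = C.quiverForm x y := by
  have h (a b : Vertex C.p) : x a * y b = ∑ v, ∑ w, x v * y w *
      ((Pi.single v 1 : Vertex C.p → ℤ) a * (Pi.single w 1 : Vertex C.p → ℤ) b) := by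
    simp [Pi.single_apply]
  simp only [eulerForm, (C.extFinite_and_eulerChar _ _).2, dimVec_simple]
  simp only [quiverForm, mul_add, mul_sub, Finset.sum_add_distrib, Finset.sum_sub_distrib]
  congr 1
  · congr 1
    · simp only [Finset.mul_sum]
      refine ((Finset.sum_congr rfl fun v _ => Finset.sum_comm).trans Finset.sum_comm).trans ?_
      exact Finset.sum_congr rfl fun u _ => (h u u).symm
    · simp only [Finset.mul_sum]
      refine ((Finset.sum_congr rfl fun v _ => Finset.sum_comm).trans Finset.sum_comm).trans ?_
      exact Finset.sum_congr rfl fun α _ => (h (source α) (target α)).symm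
  · rw [h]
    simp only [Finset.mul_sum]
    exact Finset.sum_congr rfl fun v _ => Finset.sum_congr rfl fun w _ => by ring

theorem vertexAt_mid (i : Fin C.n) (a : Fin (C.p i - 1)) :
    vertexAt C.p i (a + 1) = Vertex.mid i a := by
  rw [vertexAt, if_neg (by omega), dif_pos (by simp)]
  rfl

theorem sum_vertex {R : Type*} [AddCommMonoid R] (f : Vertex C.p → R) :
    ∑ v, f v = f Vertex.zero + (f Vertex.c + ∑ i, ∑ a, f (Vertex.mid i a)) := by
  let e : Option (Option (Σ i : Fin C.n, Fin (C.p i - 1))) ≃ Vertex C.p :=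
    { toFun
        | none => Vertex.zero
        | some none => Vertex.c
        | some (some x) => Vertex.mid x.1 x.2
      invFun
        | Vertex.zero => none
        | Vertex.c => some none
        | Vertex.mid i a => some (some ⟨i, a⟩)
      left_inv := by rintro (_ | _ | x) <;> rfl
      right_inv := by rintro (_ | _ | _) <;> rfl }
  rw [← e.sum_comp, Fintype.sum_option, Fintype.sum_option, Fintype.sum_sigma]
  rfl

/-- The Euler form of the vector `(1, …, 1)` is the difference of the dimensions at the source and
the sink. -/
theorem eulerForm_one (y : Vertex C.p → ℤ) :
    C.eulerForm 1 y = y Vertex.zero - y Vertex.c := by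
  have h (i : Fin C.n) : ∑ a : Fin (C.p i), y (vertexAt C.p i (a + 1)) =
      ∑ a, y (Vertex.mid i a) + y Vertex.c := by
    have h1 : C.p i - 1 + 1 = C.p i := Nat.sub_add_cancel (C.one_le i)
    simp only [← vertexAt_mid]
    rw [Fin.sum_univ_eq_sum_range (fun a => y (vertexAt C.p i (a + 1))),
      Fin.sum_univ_eq_sum_range (fun a => y (vertexAt C.p i (a + 1))), ← h1,
      Finset.sum_range_succ, Nat.add_sub_cancel, h1, vertexAt_length]
  simp only [eulerForm_eq_quiverForm, quiverForm, Pi.one_apply, one_mul]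
  rw [sum_vertex, Fintype.sum_sigma]
  simp only [target, h, Finset.sum_add_distrib, Finset.sum_const, Finset.card_univ,
    Fintype.card_fin, nsmul_eq_mul]
  ring

/-! ### Left derived functors by projective resolutions of length two -/

section LeftDerived

universe v₁ v₂ u₁ u₂

variable {𝒜 : Type u₁} [Category.{v₁} 𝒜] [Abelian 𝒜] {P₂ P₁ P₀ X : 𝒜} (d₂ : P₂ ⟶ P₁)
  (d₁ : P₁ ⟶ P₀) (ε : P₀ ⟶ X)

open Limits ZeroObject

/-- The objects of the complex `⋯ → 0 → P₂ → P₁ → P₀`. -/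
def lengthTwoX (P₂ P₁ P₀ : 𝒜) : ℕ → 𝒜
  | 0 => P₀
  | 1 => P₁
  | 2 => P₂
  | _ + 3 => 0

/-- The differentials of the complex `⋯ → 0 → P₂ → P₁ → P₀`. -/
def lengthTwoD : ∀ n, lengthTwoX P₂ P₁ P₀ (n + 1) ⟶ lengthTwoX P₂ P₁ P₀ n
  | 0 => d₁
  | 1 => d₂
  | _ + 2 => 0

/-- The complex `⋯ → 0 → P₂ → P₁ → P₀`. -/
def lengthTwoComplex (w : d₂ ≫ d₁ = 0) : ChainComplex 𝒜 ℕ :=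
  ChainComplex.of (lengthTwoX P₂ P₁ P₀) (lengthTwoD d₂ d₁) fun
    | 0 => w
    | _ + 1 => zero_comp

theorem lengthTwoComplex_d (w : d₂ ≫ d₁ = 0) (n : ℕ) :
    (lengthTwoComplex d₂ d₁ w).d (n + 1) n = lengthTwoD d₂ d₁ n :=
  ChainComplex.of_d _ _ _

theorem lengthTwoComplex_exactAt [Mono d₂] (w : d₂ ≫ d₁ = 0)
    (h : (ShortComplex.mk d₂ d₁ w).Exact) (n : ℕ) :
    (lengthTwoComplex d₂ d₁ w).ExactAt (n + 1) := by
  rw [HomologicalComplex.exactAt_iff' _ (n + 1 + 1) (n + 1) n (by simp) (by simp)]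
  match n with
  | 0 =>
    let e : ShortComplex.mk d₂ d₁ w ≅ (lengthTwoComplex d₂ d₁ w).sc' 2 1 0 :=
      ShortComplex.isoMk (Iso.refl P₂) (Iso.refl P₁) (Iso.refl P₀)
        ((Category.id_comp _).trans
          ((lengthTwoComplex_d d₂ d₁ w 1).trans (Category.comp_id d₂).symm))
        ((Category.id_comp _).trans
          ((lengthTwoComplex_d d₂ d₁ w 0).trans (Category.comp_id d₁).symm))
    exact ShortComplex.exact_of_iso e h
  | 1 =>
    have : Mono ((lengthTwoComplex d₂ d₁ w).sc' 3 2 1).g := by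
      have e : ((lengthTwoComplex d₂ d₁ w).sc' 3 2 1).g = d₂ := lengthTwoComplex_d d₂ d₁ w 1
      rw [e]
      exact ‹Mono d₂›
    exact ((lengthTwoComplex d₂ d₁ w).sc' 3 2 1).exact_iff_mono
      (lengthTwoComplex_d d₂ d₁ w 2) |>.2 this
  | n + 2 => exact ShortComplex.exact_of_isZero_X₂ _ (isZero_zero 𝒜)

/-- A projective resolution of length two. -/
def lengthTwoResolution [Projective P₀] [Projective P₁] [Projective P₂] [Mono d₂] [Epi ε]
    (w : d₂ ≫ d₁ = 0) (h : (ShortComplex.mk d₂ d₁ w).Exact) (w' : d₁ ≫ ε = 0)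
    (h' : (ShortComplex.mk d₁ ε w').Exact) : ProjectiveResolution X where
  complex := lengthTwoComplex d₂ d₁ w
  projective
    | 0 => inferInstanceAs (Projective P₀)
    | 1 => inferInstanceAs (Projective P₁)
    | 2 => inferInstanceAs (Projective P₂)
    | _ + 3 => inferInstanceAs (Projective (0 : 𝒜))
  π := (ChainComplex.toSingle₀Equiv _ _).symm ⟨ε, by
    rw [lengthTwoComplex_d]
    exact w'⟩
  quasiIso := ⟨fun n => by
    cases n
    · rw [ChainComplex.quasiIsoAt₀_iff, ShortComplex.quasiIso_iff_of_zeros']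
      · refine (ShortComplex.exact_and_epi_g_iff_of_iso ?_).2 ⟨h', inferInstanceAs (Epi ε)⟩
        refine ShortComplex.isoMk (Iso.refl _) (Iso.refl _) (Iso.refl _) ?_ ?_
        · exact (Category.id_comp _).trans
            ((lengthTwoComplex_d d₂ d₁ w 0).symm.trans (Category.comp_id _).symm)
        · refine (Category.id_comp _).trans (Eq.trans ?_ (Category.comp_id _).symm)
          exact (ChainComplex.toSingle₀Equiv_symm_apply_f_zero
            (C := lengthTwoComplex d₂ d₁ w) (X := X) ε _).symm
      all_goals rfl
    · rw [quasiIsoAt_iff_exactAt' (hL := ChainComplex.exactAt_succ_single_obj X _)]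
      exact lengthTwoComplex_exactAt d₂ d₁ w h _⟩

variable {ℬ : Type u₂} [Category.{v₂} ℬ] [Abelian ℬ] [HasProjectiveResolutions 𝒜]
  (F : 𝒜 ⥤ ℬ) [F.Additive]

/-- The first left derived functor is the homology of the image of the resolution. -/
theorem nonempty_leftDerived_one_iso [Projective P₀] [Projective P₁] [Projective P₂] [Mono d₂]
    [Epi ε] (w : d₂ ≫ d₁ = 0) (h : (ShortComplex.mk d₂ d₁ w).Exact) (w' : d₁ ≫ ε = 0)
    (h' : (ShortComplex.mk d₁ ε w').Exact) (w'' : F.map d₂ ≫ F.map d₁ = 0) :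
    Nonempty ((F.leftDerived 1).obj X ≅ (ShortComplex.mk (F.map d₂) (F.map d₁) w'').homology) := by
  refine ⟨(lengthTwoResolution d₂ d₁ ε w h w' h').isoLeftDerivedObj F 1 ≪≫
    ShortComplex.homologyMapIso (HomologicalComplex.isoSc' _ 2 1 0 (by simp) (by simp) ≪≫ ?_)⟩
  refine ShortComplex.isoMk (Iso.refl _) (Iso.refl _) (Iso.refl _) ?_ ?_
  · exact (Category.id_comp _).trans
      ((congrArg F.map (lengthTwoComplex_d d₂ d₁ w 1).symm).trans (Category.comp_id _).symm)
  · exact (Category.id_comp _).trans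
      ((congrArg F.map (lengthTwoComplex_d d₂ d₁ w 0).symm).trans (Category.comp_id _).symm)

/-- If the left derived functor of degree zero vanishes, then the image of the last differential
of the resolution is an epimorphism. -/
theorem epi_map_of_isZero_leftDerived_zero [Projective P₀] [Projective P₁] [Projective P₂]
    [Mono d₂] [Epi ε] (w : d₂ ≫ d₁ = 0) (h : (ShortComplex.mk d₂ d₁ w).Exact) (w' : d₁ ≫ ε = 0)
    (h' : (ShortComplex.mk d₁ ε w').Exact) (hF : IsZero ((F.leftDerived 0).obj X)) :
    Epi (F.map d₁) := by
  have h0 := hF.of_iso ((lengthTwoResolution d₂ d₁ ε w h w' h').isoLeftDerivedObj F 0).symm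
  have h1 := (HomologicalComplex.exactAt_iff_isZero_homology _ _).2 h0
  rw [HomologicalComplex.exactAt_iff' _ 1 0 0 (by simp) ChainComplex.next_nat_zero] at h1
  have h2 := h1.epi_f (((F.mapHomologicalComplex (ComplexShape.down ℕ)).obj
    (lengthTwoResolution d₂ d₁ ε w h w' h').complex).shape 0 0 (Nat.succ_ne_zero 0))
  have e : F.map d₁ = F.map ((lengthTwoComplex d₂ d₁ w).d 1 0) :=
    congrArg F.map (lengthTwoComplex_d d₂ d₁ w 0).symm
  rw [e]
  exact h2

end LeftDerived

/-! ### The Nakayama functor on projective modules -/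

section TensorDual

variable {A : Type u} [Ring A] [Algebra k A]

/-- The class of `m ⊗ f` in `M ⊗_A DA`. -/
def tensorDualMk (M : ModuleCat.{u} Aᵐᵒᵖ) (f : DualBimodule k A) (m : M) :
    (tensorDual k A).obj M :=
  Submodule.Quotient.mk (f ⊗ₜ[k] m)

theorem tensorDual_induction {M : ModuleCat.{u} Aᵐᵒᵖ} {P : (tensorDual k A).obj M → Prop}
    (zero : P 0) (mk : ∀ f m, P (tensorDualMk M f m)) (add : ∀ s t, P s → P t → P (s + t))
    (t : (tensorDual k A).obj M) : P t := by
  obtain ⟨t, rfl⟩ := Submodule.Quotient.mk_surjective _ t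
  induction t using TensorProduct.induction_on with
  | zero => exact zero
  | tmul f g => exact mk f g
  | add s t hs ht => exact add _ _ hs ht

theorem tensorDual_map_mk {M N : ModuleCat.{u} Aᵐᵒᵖ} (φ : M ⟶ N) (f : DualBimodule k A) (m : M) :
    ((tensorDual k A).map φ).hom (tensorDualMk M f m) = tensorDualMk N f (φ.hom m) := rfl

theorem tensorDualMk_smul (M : ModuleCat.{u} Aᵐᵒᵖ) (f : DualBimodule k A) (m : M) (a : A) :
    tensorDualMk M f (op a • m) = tensorDualMk M (a • f) m :=
  (Submodule.Quotient.eq _).2 (Submodule.subset_span ⟨m, a, f, rfl⟩)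

theorem tensorDualMk_add_left (M : ModuleCat.{u} Aᵐᵒᵖ) (f f' : DualBimodule k A) (m : M) :
    tensorDualMk M (f + f') m = tensorDualMk M f m + tensorDualMk M f' m :=
  congrArg Submodule.Quotient.mk (TensorProduct.add_tmul f f' m)

theorem tensorDualMk_sum_right (M : ModuleCat.{u} Aᵐᵒᵖ) (f : DualBimodule k A) {ι : Type*}
    (s : Finset ι) (m : ι → M) :
    tensorDualMk M f (∑ i ∈ s, m i) = ∑ i ∈ s, tensorDualMk M f (m i) := by
  classical
  induction s using Finset.cons_induction with
  | empty => exact congrArg Submodule.Quotient.mk (TensorProduct.tmul_zero _ f)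
  | cons j s hj ih =>
    rw [Finset.sum_cons, Finset.sum_cons, ← ih]
    exact congrArg Submodule.Quotient.mk (TensorProduct.tmul_add f _ _)

theorem tensorDualMk_zero_left (M : ModuleCat.{u} Aᵐᵒᵖ) (m : M) :
    tensorDualMk M (0 : DualBimodule k A) m = 0 :=
  congrArg Submodule.Quotient.mk (TensorProduct.zero_tmul _ m)

/-- The map `M ⊗_A DA → A ⊗_A DA = DA` induced by a map `M → A` of right modules. -/
def tensorDualEval (M : ModuleCat.{u} Aᵐᵒᵖ) (φ : M →ₗ[Aᵐᵒᵖ] A) :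
    (tensorDual k A).obj M →ₗ[Aᵐᵒᵖ] DualBimodule k A :=
  Submodule.liftQ _
    (TensorProduct.AlgebraTensorModule.lift
      { toFun f :=
          { toFun m := φ m • f
            map_add' m m' := by rw [map_add, add_smul]
            map_smul' c m := by
              rw [LinearMap.map_smul_of_tower, RingHom.id_apply]
              ext x
              simp }
        map_add' f f' := by
          ext1 m
          exact smul_add _ _ _
        map_smul' a f := by
          ext1 m
          exact smul_comm _ _ _ })
    (Submodule.span_le.2 (by
      rintro _ ⟨m, a, f, rfl⟩
      rw [SetLike.mem_coe, LinearMap.mem_ker, map_sub, sub_eq_zero]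
      change φ (op a • m) • f = φ m • a • f
      rw [map_smul, ← mul_smul]
      rfl))

end TensorDual

section DualProj

variable {J : Type} (lam : J → Vertex C.p)

/-- The image of `∏_j e_{lam j} A` under `- ⊗_A DA`. -/
abbrev projDual : C.RMod := (tensorDual k C.Alg).obj (ModuleCat.of C.Algᵐᵒᵖ (C.proj lam))

/-- The map `(∏_j e_{lam j} A) ⊗_A DA → (DA)^J` with `g ⊗ f ↦ (g j f)_j`. It is injective with
image `∏_j e_{lam j} DA`. -/
def dualCoord : C.projDual lam →ₗ[C.Algᵐᵒᵖ] (J → DualBimodule k C.Alg) :=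
  LinearMap.pi fun j => tensorDualEval (ModuleCat.of C.Algᵐᵒᵖ (C.proj lam))
    (LinearMap.proj j ∘ₗ (C.proj lam).subtype)

theorem dualCoord_mk (f : DualBimodule k C.Alg) (g : C.proj lam) (j : J) :
    C.dualCoord lam (tensorDualMk (ModuleCat.of C.Algᵐᵒᵖ (C.proj lam)) f g) j = g.1 j • f := rfl

theorem idem_smul_dualCoord (t : C.projDual lam) (j : J) :
    C.idem (lam j) • C.dualCoord lam t j = C.dualCoord lam t j := by
  induction t using tensorDual_induction with
  | zero => simp
  | mk f g => rw [dualCoord_mk, ← mul_smul, proj_apply]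
  | add s t hs ht => rw [map_add, Pi.add_apply, smul_add, hs, ht]

variable [Fintype J] [DecidableEq J]

theorem eq_sum_tensorDualMk (t : C.projDual lam) :
    t = ∑ j, tensorDualMk (ModuleCat.of C.Algᵐᵒᵖ (C.proj lam)) (C.dualCoord lam t j)
      (C.projGen lam j) := by
  induction t using tensorDual_induction with
  | zero =>
    symm
    refine Finset.sum_eq_zero fun j _ => ?_
    rw [map_zero]
    exact tensorDualMk_zero_left _ _
  | mk f g =>
    conv_lhs => rw [C.proj_eq_sum lam g]
    refine (tensorDualMk_sum_right _ _ _ _).trans (Finset.sum_congr rfl fun j _ => ?_)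
    exact tensorDualMk_smul _ _ _ _
  | add s t hs ht =>
    conv_lhs => rw [hs, ht]
    rw [← Finset.sum_add_distrib]
    refine Finset.sum_congr rfl fun j _ => ?_
    rw [map_add, Pi.add_apply, tensorDualMk_add_left]

theorem dualCoord_injective : Function.Injective (C.dualCoord lam) := fun s t h => by
  rw [C.eq_sum_tensorDualMk lam s, C.eq_sum_tensorDualMk lam t, h]

variable {lam} in
theorem exists_dualCoord_eq {h : J → DualBimodule k C.Alg}
    (hh : ∀ j, C.idem (lam j) • h j = h j) : ∃ t, C.dualCoord lam t = h := by
  refine ⟨∑ j, tensorDualMk (ModuleCat.of C.Algᵐᵒᵖ (C.proj lam)) (h j) (C.projGen lam j), ?_⟩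
  ext1 i
  rw [map_sum, Finset.sum_apply, Finset.sum_eq_single i]
  · rw [dualCoord_mk, projGen_val, if_pos rfl, hh]
  · intro j _ hj
    rw [dualCoord_mk, projGen_val, if_neg (Ne.symm hj), zero_smul]
  · simp

theorem dualCoord_map {J' : Type} (lam' : J' → Vertex C.p)
    (φ : C.proj lam →ₗ[C.Algᵐᵒᵖ] C.proj lam') (t : C.projDual lam) (i : J') :
    C.dualCoord lam' (((tensorDual k C.Alg).map (ModuleCat.ofHom φ)).hom t) i =
      ∑ j, (φ (C.projGen lam j)).1 i • C.dualCoord lam t j := by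
  induction t using tensorDual_induction with
  | zero => simp
  | mk f g =>
    rw [tensorDual_map_mk, ModuleCat.hom_ofHom, dualCoord_mk]
    conv_lhs => rw [C.proj_eq_sum lam g, map_sum, AddSubmonoidClass.coe_finsetSum,
      Finset.sum_apply, Finset.sum_smul]
    refine Finset.sum_congr rfl fun j _ => ?_
    rw [dualCoord_mk, ← mul_smul, map_smul]
    rfl
  | add s t hs ht =>
    rw [map_add, map_add, Pi.add_apply, hs, ht, ← Finset.sum_add_distrib]
    refine Finset.sum_congr rfl fun j _ => ?_
    rw [map_add, Pi.add_apply, smul_add]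

end DualProj

/-! ### The Nakayama functor along the arms -/

theorem source_eq_mid {i : Fin C.n} {a : ℕ} (h : a + 1 < C.p i) :
    source (⟨i, ⟨a + 1, h⟩⟩ : Arrow C.p) = Vertex.mid i ⟨a, by omega⟩ :=
  C.vertexAt_mid i ⟨a, by omega⟩

theorem target_eq_mid {i : Fin C.n} {a : ℕ} (h : a + 1 < C.p i) :
    target (⟨i, ⟨a, by omega⟩⟩ : Arrow C.p) = Vertex.mid i ⟨a, by omega⟩ :=
  C.vertexAt_mid i ⟨a, by omega⟩

theorem source_eq_mid_iff {i : Fin C.n} {a : ℕ} (h : a + 1 < C.p i) (α : Arrow C.p) :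
    source α = Vertex.mid i ⟨a, by omega⟩ ↔ α = ⟨i, ⟨a + 1, h⟩⟩ := by
  refine ⟨fun hα => ?_, fun hα => hα ▸ C.source_eq_mid h⟩
  obtain ⟨i', b, hb⟩ := α
  rcases b with _ | b
  · simp [source, vertexAt] at hα
  · rw [C.source_eq_mid hb] at hα
    simp only [Vertex.mid.injEq] at hα
    obtain ⟨rfl, hα⟩ := hα
    simpa using hα

theorem target_eq_mid_iff {i : Fin C.n} {a : ℕ} (h : a + 1 < C.p i) (α : Arrow C.p) :
    target α = Vertex.mid i ⟨a, by omega⟩ ↔ α = ⟨i, ⟨a, by omega⟩⟩ := by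
  refine ⟨fun hα => ?_, fun hα => hα ▸ C.target_eq_mid h⟩
  obtain ⟨i', b, hb⟩ := α
  by_cases hb' : b + 1 < C.p i'
  · rw [C.target_eq_mid hb'] at hα
    simp only [Vertex.mid.injEq] at hα
    obtain ⟨rfl, hα⟩ := hα
    simpa using hα
  · have : b + 1 = C.p i' := by omega
    simp [target, this, vertexAt_length] at hα

/-- The character of a vertex, as an element of `DA`. It spans the socle of the left module
`DA e_v`. -/
def charDual (v : Vertex C.p) : DualBimodule k C.Alg := (C.character v).toLinearMap

theorem dualBimodule_smul_comm (a : C.Alg) (c : k) (f : DualBimodule k C.Alg) :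
    a • c • f = c • a • f := by
  ext x
  simp

theorem charDual_apply (v : Vertex C.p) (a : C.Alg) : C.charDual v a = C.character v a := rfl

theorem smul_charDual (v : Vertex C.p) (a : C.Alg) :
    a • C.charDual v = C.character v a • C.charDual v := by
  ext x
  rw [DualBimodule.left_smul_apply, DualBimodule.smul_apply, charDual_apply, charDual_apply,
    map_mul, mul_comm]

theorem op_smul_charDual (v : Vertex C.p) (a : C.Alg) :
    op a • C.charDual v = C.character v a • C.charDual v := by
  ext x
  rw [DualBimodule.right_smul_apply, DualBimodule.smul_apply, charDual_apply, charDual_apply,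
    unop_op, map_mul]

/-- At a vertex `v` with only one outgoing arrow `β`, one has `e_v A = k e_v + β A`. -/
theorem exists_idem_mul_eq {i : Fin C.n} {a : ℕ} (h : a + 1 < C.p i) (x : C.Alg) :
    ∃ y, C.idem (Vertex.mid i ⟨a, by omega⟩) * x =
      C.character (Vertex.mid i ⟨a, by omega⟩) x • C.idem (Vertex.mid i ⟨a, by omega⟩) +
        C.arr ⟨i, ⟨a + 1, h⟩⟩ * y := by
  induction x using alg_induction with
  | algebraMap c =>
    refine ⟨0, ?_⟩
    rw [AlgHom.commutes, mul_zero, add_zero, Algebra.algebraMap_eq_smul_one, mul_smul_comm, mul_one]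
    rfl
  | idem v =>
    refine ⟨0, ?_⟩
    rw [character_idem, idem_mul_idem, mul_zero, add_zero]
    split_ifs with h1 h2 h2
    · rw [one_smul]
    · exact absurd h1.symm h2
    · exact absurd h2.symm h1
    · rw [zero_smul]
  | arr α =>
    rw [idem_mul_arr, character_arr, zero_smul]
    split_ifs with h1
    · exact ⟨1, by rw [zero_add, mul_one, (C.source_eq_mid_iff h α).1 h1.symm]⟩
    · exact ⟨0, by rw [zero_add, mul_zero]⟩
  | mul x x' hx hx' =>
    obtain ⟨y, hy⟩ := hx
    obtain ⟨y', hy'⟩ := hx'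
    refine ⟨C.character (Vertex.mid i ⟨a, by omega⟩) x • y' + y * x', ?_⟩
    rw [← mul_assoc, hy, add_mul, smul_mul_assoc, hy', map_mul, smul_add, mul_smul, mul_add,
      mul_smul_comm, add_assoc, mul_assoc]
  | add x x' hx hx' =>
    obtain ⟨y, hy⟩ := hx
    obtain ⟨y', hy'⟩ := hx'
    refine ⟨y + y', ?_⟩
    rw [mul_add, hy, hy', map_add, add_smul, mul_add]
    abel

/-- A functional on `e_v A` which vanishes on `β A`, where `β` is the only arrow that starts at
`v`, is a multiple of the character of `v`. -/
theorem eq_smul_charDual {i : Fin C.n} {a : ℕ} (h : a + 1 < C.p i) {f : DualBimodule k C.Alg}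
    (h1 : op (C.arr ⟨i, ⟨a + 1, h⟩⟩) • f = 0)
    (h2 : op (C.idem (Vertex.mid i ⟨a, by omega⟩)) • f = f) :
    f = f (C.idem (Vertex.mid i ⟨a, by omega⟩)) • C.charDual (Vertex.mid i ⟨a, by omega⟩) := by
  ext x
  obtain ⟨y, hy⟩ := C.exists_idem_mul_eq h x
  have h3 : f (C.arr ⟨i, ⟨a + 1, h⟩⟩ * y) = 0 := congrArg (fun g : DualBimodule k C.Alg => g y) h1
  have h4 : f (C.idem (Vertex.mid i ⟨a, by omega⟩) * x) = f x :=
    congrArg (fun g : DualBimodule k C.Alg => g x) h2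
  rw [← h4, hy, DualBimodule.map_add', h3, add_zero, DualBimodule.map_smul',
    DualBimodule.smul_apply, charDual_apply, mul_comm]

/-- Right multiplication by an arrow `β` that does not start at `0` is surjective on `DA`, since
left multiplication by `β` is injective on `A`. -/
theorem exists_op_arr_smul_eq {β : Arrow C.p} (hβ : β.2.val ≠ 0) {v : Vertex C.p}
    {f : DualBimodule k C.Alg} (h1 : op (C.idem (target β)) • f = f) (h2 : C.idem v • f = f) :
    ∃ g : DualBimodule k C.Alg, op (C.arr β) • g = f ∧ C.idem v • g = g ∧
      op (C.idem (source β)) • g = g := by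
  let L : C.Alg →ₗ[k] C.Alg := LinearMap.mulLeft k (C.arr β)
  have hker : (show C.Alg →ₗ[k] k from f) ∈ (LinearMap.ker L).dualAnnihilator := by
    rw [Submodule.mem_dualAnnihilator]
    intro x hx
    have hx' := C.idem_target_mul_eq_zero hβ (LinearMap.mem_ker.1 hx)
    have : f (C.idem (target β) * x) = f x := congrArg (fun g : DualBimodule k C.Alg => g x) h1
    change f x = 0
    rw [← this, hx', DualBimodule.map_zero']
  rw [← LinearMap.range_dualMap_eq_dualAnnihilator_ker] at hker
  obtain ⟨H, hH⟩ := hker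
  have hH' (x : C.Alg) : (show DualBimodule k C.Alg from H) (C.arr β * x) = f x :=
    LinearMap.congr_fun hH x
  refine ⟨C.idem v • op (C.idem (source β)) • (show DualBimodule k C.Alg from H), ?_, ?_, ?_⟩
  · ext x
    rw [DualBimodule.right_smul_apply, DualBimodule.left_smul_apply,
      DualBimodule.right_smul_apply, unop_op, unop_op, ← mul_assoc, ← mul_assoc, source_mul_arr,
      mul_assoc, hH', ← DualBimodule.left_smul_apply, h2]
  · rw [← mul_smul, idem_mul_self]
  · rw [← smul_comm, ← mul_smul, ← op_mul, idem_mul_self]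

section

variable {J : Type} [Fintype J] [DecidableEq J] {lam : J → Vertex C.p}

/-- Right multiplication by an arrow that does not start at `0` is surjective on every
`e_v DA`. -/
theorem exists_op_arr_smul_projDual_eq {β : Arrow C.p} (hβ : β.2.val ≠ 0) {t : C.projDual lam}
    (ht : op (C.idem (target β)) • t = t) :
    ∃ s : C.projDual lam, op (C.arr β) • s = t ∧ op (C.idem (source β)) • s = s := by
  choose g h1 h2 h3 using fun j => C.exists_op_arr_smul_eq hβ
    (f := C.dualCoord lam t j) (by rw [← Pi.smul_apply, ← map_smul, ht])
    (C.idem_smul_dualCoord lam t j)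
  obtain ⟨s, hs⟩ := C.exists_dualCoord_eq h2
  refine ⟨s, C.dualCoord_injective lam ?_, C.dualCoord_injective lam ?_⟩
  · rw [map_smul, hs]
    exact funext h1
  · rw [map_smul, hs]
    exact funext h3

end

section

variable {X : Type u} [AddCommGroup X] [Module k X] [Module C.Algᵐᵒᵖ X]
  [IsScalarTower k C.Algᵐᵒᵖ X] {J : Type} [Fintype J] [DecidableEq J] (lam : J → Vertex C.p)
  (b : Module.Basis J k X)

/-- The image of the differential from degree one to degree zero under `- ⊗_A DA`. -/
abbrev dualD₁ : C.projDual (C.arrowVertex lam) →ₗ[C.Algᵐᵒᵖ] C.projDual lam :=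
  ((tensorDual k C.Alg).map (ModuleCat.ofHom (C.resD₁ lam b))).hom

/-- The image of the differential from degree two to degree one under `- ⊗_A DA`. -/
abbrev dualD₂ : C.projDual (C.relVertex lam) →ₗ[C.Algᵐᵒᵖ] C.projDual (C.arrowVertex lam) :=
  ((tensorDual k C.Alg).map (ModuleCat.ofHom (C.resD₂ lam b))).hom

variable {C lam b} (hb : C.IsVertexBasis lam b)
include hb

theorem dualCoord_dualD₁ (t : C.projDual (C.arrowVertex lam)) (j : J) :
    C.dualCoord lam (C.dualD₁ lam b t) j =
      ∑ z, (b.repr (b z.1.2) j • (C.idem (lam j) * C.arr z.1.1) -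
        b.repr (op (C.arr z.1.1) • b z.1.2) j • C.idem (lam j)) •
          C.dualCoord (C.arrowVertex lam) t z := by
  rw [dualCoord_map]
  refine Finset.sum_congr rfl fun z _ => ?_
  rw [resD₁_projGen hb]
  congr 1
  change b.repr (b z.1.2) j • (C.idem (lam j) * C.arr z.1.1) -
    b.repr (op (C.arr z.1.1) • b z.1.2) j • (C.idem (lam j) * 1) = _
  rw [mul_one]

/-- On the chains with coordinates in the socle that are supported at one arrow `α`, the
differential is, up to the sign, the action of `α` on `X`. -/
theorem dualCoord_dualD₁_charDual {α : Arrow C.p} {c : C.ArrowIndex lam → k}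
    {t : C.projDual (C.arrowVertex lam)}
    (ht : ∀ z, C.dualCoord (C.arrowVertex lam) t z =
      if z.1.1 = α then c z • C.charDual (target α) else 0) (j : J) :
    C.dualCoord lam (C.dualD₁ lam b t) j =
      -(b.repr (op (C.arr α) • ∑ z, if z.1.1 = α then c z • b z.1.2 else 0) j •
        C.charDual (target α)) := by
  rw [dualCoord_dualD₁ hb]
  have hlin : b.repr (op (C.arr α) • ∑ z : C.ArrowIndex lam,
      if z.1.1 = α then c z • b z.1.2 else 0) j =
      ∑ z, if z.1.1 = α then c z * b.repr (op (C.arr α) • b z.1.2) j else 0 := by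
    rw [Finset.smul_sum, map_sum, Finsupp.finsetSum_apply]
    refine Finset.sum_congr rfl fun z _ => ?_
    split_ifs
    · rw [smul_algebra_smul_comm, map_smul]
      rfl
    · simp
  rw [hlin, Finset.sum_smul, ← Finset.sum_neg_distrib]
  refine Finset.sum_congr rfl fun z _ => ?_
  rw [ht]
  split_ifs with hz
  · subst hz
    have h1 : b.repr (op (C.arr z.1.1) • b z.1.2) j =
        if lam j = target z.1.1 then b.repr (op (C.arr z.1.1) • b z.1.2) j else 0 := by
      conv_lhs => rw [← arr_mul_target, op_mul, mul_smul, hb.repr_idem_smul]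
    have h2 : (b.repr (b z.1.2) j • (C.idem (lam j) * C.arr z.1.1) -
        b.repr (op (C.arr z.1.1) • b z.1.2) j • C.idem (lam j)) • C.charDual (target z.1.1) =
        -(b.repr (op (C.arr z.1.1) • b z.1.2) j • C.charDual (target z.1.1)) := by
      rw [smul_charDual, map_sub, map_smul, map_smul, map_mul, character_arr, character_idem, h1]
      split_ifs <;> simp
    rw [dualBimodule_smul_comm, h2, smul_neg, mul_smul]
  · simp

end

/-! ### Serre stability and the arrows of an arm -/

/-- Right multiplication by `a` maps `M` onto `M e`. -/
def ActsSurj {A : Type u} [Ring A] (e a : A) (M : ModuleCat.{u} Aᵐᵒᵖ) : Prop :=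
  ∀ x : M, op e • x = x → ∃ y : M, op a • y = x

section ActsSurj

variable {A : Type u} [Ring A] {e a : A}

theorem ActsSurj.of_iso {M N : ModuleCat.{u} Aᵐᵒᵖ} (h : ActsSurj e a M) (φ : M ≅ N) :
    ActsSurj e a N := fun x hx => by
  obtain ⟨y, hy⟩ := h (φ.inv.hom x) (by rw [← map_smul, hx])
  exact ⟨φ.hom.hom y, by rw [← map_smul, hy]; exact congrArg (fun f => f.hom x) φ.inv_hom_id⟩

theorem actsSurj_congr {M N : ModuleCat.{u} Aᵐᵒᵖ} (φ : M ≅ N) :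
    ActsSurj e a M ↔ ActsSurj e a N :=
  ⟨fun h => h.of_iso φ, fun h => h.of_iso φ.symm⟩

/-- Surjectivity on the homology of a complex in terms of cycles and boundaries. -/
theorem actsSurj_homology_iff (he : e * e = e) (S : ShortComplex (ModuleCat.{u} Aᵐᵒᵖ)) :
    ActsSurj e a S.homology ↔ ∀ z' : S.X₂, S.g.hom z' = 0 → op e • z' = z' →
      ∃ (z : S.X₂) (u : S.X₁), S.g.hom z = 0 ∧ z' = op a • z + S.f.hom u := by
  rw [actsSurj_congr S.moduleCatHomologyIso]
  constructor
  · intro h z' hz' hz'e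
    obtain ⟨y, hy⟩ := h (Submodule.Quotient.mk ⟨z', hz'⟩)
      (congrArg Submodule.Quotient.mk (Subtype.ext hz'e))
    obtain ⟨⟨z, hz⟩, rfl⟩ := Submodule.Quotient.mk_surjective _ y
    obtain ⟨u, hu⟩ := (Submodule.Quotient.eq (LinearMap.range S.moduleCatToCycles)).1 hy.symm
    refine ⟨z, u, hz, ?_⟩
    have : S.f.hom u = z' - op a • z := congrArg Subtype.val hu
    rw [this, add_sub_cancel]
  · intro h x hx
    obtain ⟨⟨z', hz'⟩, rfl⟩ := Submodule.Quotient.mk_surjective _ x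
    obtain ⟨z, u, hz, hu⟩ := h (op e • z')
      (by rw [map_smul]; exact (congrArg _ hz').trans (smul_zero _))
      (by rw [← mul_smul, ← op_mul, he])
    refine ⟨Submodule.Quotient.mk ⟨z, hz⟩, ?_⟩
    rw [← hx]
    refine (Submodule.Quotient.eq (LinearMap.range S.moduleCatToCycles)).2 ⟨-u, Subtype.ext ?_⟩
    change S.f.hom (-u) = op a • z - op e • z'
    rw [hu, map_neg]
    abel

end ActsSurj

section

variable {X : Type u} [AddCommGroup X] [Module k X] [Module C.Algᵐᵒᵖ X]
  [IsScalarTower k C.Algᵐᵒᵖ X] {J : Type} [Fintype J] [DecidableEq J] {lam : J → Vertex C.p}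
  {b : Module.Basis J k X}

theorem sum_arrowIndex_ite {R : Type*} [AddCommMonoid R] (α : Arrow C.p)
    (f : J → R) : (∑ z : C.ArrowIndex lam, if z.1.1 = α then f z.1.2 else 0) =
      ∑ j, if lam j = source α then f j else 0 := by
  rw [← Finset.sum_filter, ← Finset.sum_filter]
  refine Finset.sum_bij (fun z _ => z.1.2) ?_ ?_ ?_ ?_
  · intro z hz
    simp only [Finset.mem_filter, Finset.mem_univ, true_and] at hz ⊢
    rw [← hz, z.2]
  · intro z hz z' hz' h
    simp only [Finset.mem_filter, Finset.mem_univ, true_and] at hz hz'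
    exact Subtype.ext (Prod.ext (hz.trans hz'.symm) h)
  · intro j hj
    simp only [Finset.mem_filter, Finset.mem_univ, true_and] at hj
    exact ⟨⟨(α, j), hj.symm⟩, by simp, rfl⟩
  · exact fun _ _ => rfl

theorem IsVertexBasis.sum_repr_ite (hb : C.IsVertexBasis lam b) (v : Vertex C.p) (x : X) :
    (∑ j, if lam j = v then b.repr x j • b j else 0) = op (C.idem v) • x := by
  conv_rhs => rw [← b.sum_repr (op (C.idem v) • x)]
  refine Finset.sum_congr rfl fun j _ => ?_
  rw [hb.repr_idem_smul]
  split_ifs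
  · rfl
  · rw [zero_smul]

theorem op_arr_smul_idem_smul {Y : Type*} [AddCommGroup Y] [Module C.Algᵐᵒᵖ Y] (α : Arrow C.p)
    (y : Y) : op (C.arr α) • op (C.idem (source α)) • y = op (C.arr α) • y := by
  rw [← mul_smul, ← op_mul, source_mul_arr]

theorem idem_smul_op_arr_smul {Y : Type*} [AddCommGroup Y] [Module C.Algᵐᵒᵖ Y] (α : Arrow C.p)
    (y : Y) : op (C.idem (target α)) • op (C.arr α) • y = op (C.arr α) • y := by
  rw [← mul_smul, ← op_mul, arr_mul_target]

/-- A vector with coordinates in `DA e_w` that are killed by the only arrow starting at `w` has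
coordinates in the socle, supported at the indices with vertex `w`. -/
theorem exists_dualCoord_eq_smul_charDual {i : Fin C.n} {a : ℕ} (h : a + 1 < C.p i)
    {t : C.projDual lam} (h1 : op (C.arr ⟨i, ⟨a + 1, h⟩⟩) • t = 0)
    (h2 : op (C.idem (Vertex.mid i ⟨a, by omega⟩)) • t = t) :
    ∃ c : J → k, (∀ j, C.dualCoord lam t j = c j • C.charDual (Vertex.mid i ⟨a, by omega⟩)) ∧
      ∀ j, lam j ≠ Vertex.mid i ⟨a, by omega⟩ → c j = 0 := by
  have key (j : J) := C.eq_smul_charDual h (f := C.dualCoord lam t j)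
    (by rw [← Pi.smul_apply, ← map_smul, h1, map_zero, Pi.zero_apply])
    (by rw [← Pi.smul_apply, ← map_smul, h2])
  refine ⟨_, key, fun j hj => ?_⟩
  have h3 := C.idem_smul_dualCoord lam t j
  rw [key j, dualBimodule_smul_comm, smul_charDual, character_idem, if_neg hj, zero_smul,
    smul_zero] at h3
  exact (key j ▸ h3.symm : C.dualCoord lam t j = 0) ▸ rfl

theorem idem_smul_charDual_of_imp {v w : Vertex C.p} {c : k} (h : v ≠ w → c = 0) :
    C.idem v • c • C.charDual w = c • C.charDual w := by
  rw [dualBimodule_smul_comm, smul_charDual, character_idem]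
  split_ifs with hvw
  · rw [one_smul]
  · rw [h hvw, zero_smul, zero_smul]

theorem op_arr_smul_smul_charDual (β : Arrow C.p) (c : k) (v : Vertex C.p) :
    op (C.arr β) • c • C.charDual v = 0 := by
  rw [smul_comm, op_smul_charDual, character_arr, zero_smul, smul_zero]

theorem op_idem_smul_smul_charDual (c : k) (v : Vertex C.p) :
    op (C.idem v) • c • C.charDual v = c • C.charDual v := by
  rw [smul_comm, op_smul_charDual, character_idem, if_pos rfl, one_smul]

variable (hb : C.IsVertexBasis lam b)
include hb

theorem dualD₁_dualD₂ (u : C.projDual (C.relVertex lam)) :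
    C.dualD₁ lam b (C.dualD₂ lam b u) = 0 := by
  have h : (tensorDual k C.Alg).map (ModuleCat.ofHom (C.resD₂ lam b)) ≫
      (tensorDual k C.Alg).map (ModuleCat.ofHom (C.resD₁ lam b)) = 0 := by
    rw [← Functor.map_comp, ← ModuleCat.ofHom_comp, resD₁_comp_resD₂ hb]
    exact Functor.map_zero _ _ _
  exact congrArg (fun f => f.hom u) h

/-- If an arrow acts surjectively on `X`, then the next arrow of the arm acts surjectively on the
homology in degree one. -/
theorem exists_cycle_of_actsSurj {i : Fin C.n} {a : ℕ} (h : a + 1 < C.p i)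
    (hX : ∀ x : X, op (C.idem (target (⟨i, ⟨a, by omega⟩⟩ : Arrow C.p))) • x = x →
      ∃ y : X, op (C.arr ⟨i, ⟨a, by omega⟩⟩) • y = x)
    {z' : C.projDual (C.arrowVertex lam)} (hz' : C.dualD₁ lam b z' = 0)
    (hz'e : op (C.idem (target (⟨i, ⟨a + 1, h⟩⟩ : Arrow C.p))) • z' = z') :
    ∃ z, C.dualD₁ lam b z = 0 ∧ z' = op (C.arr ⟨i, ⟨a + 1, h⟩⟩) • z := by
  obtain ⟨z, hz, hze⟩ := C.exists_op_arr_smul_projDual_eq (Nat.succ_ne_zero a) hz'e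
  rw [C.source_eq_mid h] at hze
  obtain ⟨c, hc, hc0⟩ := C.exists_dualCoord_eq_smul_charDual h (t := C.dualD₁ lam b z)
    (by rw [← map_smul, hz, hz']) (by rw [← map_smul, hze])
  obtain ⟨y, hy⟩ := hX (∑ j, c j • b j) (by
    rw [C.target_eq_mid h, Finset.smul_sum]
    refine Finset.sum_congr rfl fun j _ => ?_
    rw [smul_algebra_smul_comm, hb.idem_smul]
    split_ifs with hj
    · rfl
    · rw [hc0 j hj, zero_smul, zero_smul])
  obtain ⟨t, ht⟩ := C.exists_dualCoord_eq (lam := C.arrowVertex lam) (h := fun z =>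
      if z.1.1 = ⟨i, ⟨a, by omega⟩⟩ then
        (-(b.repr y z.1.2)) • C.charDual (target (⟨i, ⟨a, by omega⟩⟩ : Arrow C.p)) else 0) (by
    intro z
    split_ifs with hz
    · exact C.idem_smul_charDual_of_imp fun h => absurd (congrArg target hz) h
    · rw [smul_zero])
  have hdt : C.dualD₁ lam b t = C.dualD₁ lam b z := by
    refine C.dualCoord_injective lam (funext fun j => ?_)
    rw [hc, dualCoord_dualD₁_charDual hb (c := fun z => -(b.repr y z.1.2)) (congrFun ht),
      C.sum_arrowIndex_ite _ fun j => (-(b.repr y j)) • b j]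
    have : (∑ j, if lam j = source (⟨i, ⟨a, by omega⟩⟩ : Arrow C.p) then
        (-(b.repr y j)) • b j else 0) =
          -(op (C.idem (source (⟨i, ⟨a, by omega⟩⟩ : Arrow C.p))) • y) := by
      rw [← hb.sum_repr_ite, ← Finset.sum_neg_distrib]
      refine Finset.sum_congr rfl fun j _ => ?_
      split_ifs
      · rw [neg_smul]
      · rw [neg_zero]
    rw [this, smul_neg, op_arr_smul_idem_smul, hy, map_neg, Finsupp.neg_apply, neg_smul, neg_neg,
      b.repr_sum_self, C.target_eq_mid h]
  refine ⟨z - t, by rw [map_sub, hdt, sub_self], ?_⟩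
  have htβ : op (C.arr ⟨i, ⟨a + 1, h⟩⟩) • t = 0 := by
    refine C.dualCoord_injective _ (funext fun z => ?_)
    rw [map_smul, Pi.smul_apply, ht]
    dsimp only
    split_ifs
    · rw [op_arr_smul_smul_charDual, map_zero, Pi.zero_apply]
    · rw [smul_zero, map_zero, Pi.zero_apply]
  rw [smul_sub, hz, htβ, sub_zero]

/-- If an arrow that is not the first one of its arm acts surjectively on the homology in degree
one, then the previous arrow of the arm acts surjectively on `X`. -/
theorem exists_smul_eq_of_cycle (hsurj : Function.Surjective (C.dualD₁ lam b)) {i : Fin C.n}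
    {a : ℕ} (h : a + 1 < C.p i)
    (hH : ∀ z', C.dualD₁ lam b z' = 0 →
      op (C.idem (target (⟨i, ⟨a + 1, h⟩⟩ : Arrow C.p))) • z' = z' →
      ∃ z u, C.dualD₁ lam b z = 0 ∧ z' = op (C.arr ⟨i, ⟨a + 1, h⟩⟩) • z + C.dualD₂ lam b u)
    {x : X} (hx : op (C.idem (target (⟨i, ⟨a, by omega⟩⟩ : Arrow C.p))) • x = x) :
    ∃ y : X, op (C.arr ⟨i, ⟨a, by omega⟩⟩) • y = x := by
  rw [C.target_eq_mid h] at hx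
  obtain ⟨η, hη⟩ := C.exists_dualCoord_eq (lam := lam)
    (h := fun j => b.repr x j • C.charDual (Vertex.mid i ⟨a, by omega⟩)) (fun j =>
      C.idem_smul_charDual_of_imp fun hj => by rw [← hx, hb.repr_idem_smul, if_neg hj])
  have hηβ : op (C.arr ⟨i, ⟨a + 1, h⟩⟩) • η = 0 := by
    refine C.dualCoord_injective _ (funext fun j => ?_)
    rw [map_smul, Pi.smul_apply, hη, map_zero, Pi.zero_apply, op_arr_smul_smul_charDual]
  have hηe : op (C.idem (Vertex.mid i ⟨a, by omega⟩)) • η = η := by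
    refine C.dualCoord_injective _ (funext fun j => ?_)
    rw [map_smul, Pi.smul_apply, hη, op_idem_smul_smul_charDual]
  obtain ⟨z, hz⟩ := hsurj η
  obtain ⟨z'', u, hz'', hu⟩ := hH (op (C.arr ⟨i, ⟨a + 1, h⟩⟩) • z)
    (by rw [map_smul, hz, hηβ]) (C.idem_smul_op_arr_smul _ _)
  obtain ⟨v, hv, hve⟩ := C.exists_op_arr_smul_projDual_eq (β := ⟨i, ⟨a + 1, h⟩⟩)
    (Nat.succ_ne_zero a)
    (t := op (C.idem (target (⟨i, ⟨a + 1, h⟩⟩ : Arrow C.p))) • u)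
    (by rw [← mul_smul, ← op_mul, idem_mul_self])
  rw [C.source_eq_mid h] at hve
  have hu' : op (C.arr ⟨i, ⟨a + 1, h⟩⟩) • z = op (C.arr ⟨i, ⟨a + 1, h⟩⟩) • z'' +
      C.dualD₂ lam b (op (C.arr ⟨i, ⟨a + 1, h⟩⟩) • v) := by
    rw [hv, ← C.idem_smul_op_arr_smul _ z, hu, smul_add, idem_smul_op_arr_smul, map_smul]
  have he (t : C.projDual (C.arrowVertex lam)) : op (C.arr ⟨i, ⟨a + 1, h⟩⟩) •
      op (C.idem (Vertex.mid i ⟨a, by omega⟩)) • t = op (C.arr ⟨i, ⟨a + 1, h⟩⟩) • t := by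
    rw [← C.source_eq_mid h, op_arr_smul_idem_smul]
  -- The element `κ` of degree one is killed by the arrow and has the boundary `η`.
  obtain ⟨κ, hκ⟩ : ∃ κ, κ = op (C.idem (Vertex.mid i ⟨a, by omega⟩)) • (z - z'') -
    C.dualD₂ lam b v := ⟨_, rfl⟩
  have hκd : C.dualD₁ lam b κ = η := by
    rw [hκ, map_sub, map_smul, map_sub, hz, hz'', sub_zero, hηe, C.dualD₁_dualD₂ hb, sub_zero]
  obtain ⟨c, hc, hc0⟩ := C.exists_dualCoord_eq_smul_charDual h (t := κ)
    (by rw [hκ, smul_sub, he, smul_sub, hu', ← map_smul]; abel)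
    (by rw [hκ, smul_sub, ← mul_smul, ← op_mul, idem_mul_self, ← map_smul, hve])
  refine ⟨-∑ z : C.ArrowIndex lam, if z.1.1 = ⟨i, ⟨a, by omega⟩⟩ then c z • b z.1.2 else 0, ?_⟩
  have hcoord (j : J) := dualCoord_dualD₁_charDual hb (α := ⟨i, ⟨a, by omega⟩⟩) (c := c) (t := κ)
    (fun z => by
      rw [hc, C.target_eq_mid h]
      split_ifs with hzα
      · rfl
      · rw [hc0 z fun hz => hzα ((C.target_eq_mid_iff h _).1 hz), zero_smul]) j
  refine b.repr.injective (Finsupp.ext fun j => ?_)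
  have h3 := hcoord j
  rw [hκd, hη, C.target_eq_mid h] at h3
  have h4 := congrArg (fun f : DualBimodule k C.Alg => f (C.idem (Vertex.mid i ⟨a, by omega⟩))) h3
  dsimp only at h4
  rw [← neg_smul, DualBimodule.smul_apply, DualBimodule.smul_apply, charDual_apply, character_idem,
    if_pos rfl, mul_one, mul_one] at h4
  rw [smul_neg, map_neg, Finsupp.neg_apply, h4]

/-- If the term of degree zero of the homology vanishes and `X e_c ≠ 0`, then some arrow ending
at `c` acts as a nonzero map on `X`. -/
theorem exists_arrow_smul_ne_zero (hsurj : Function.Surjective (C.dualD₁ lam b)) {j : J}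
    (hj : lam j = Vertex.c) :
    ∃ (α : Arrow C.p) (x : X), target α = Vertex.c ∧ op (C.arr α) • x ≠ 0 := by
  by_contra! hcon
  obtain ⟨η, hη⟩ := C.exists_dualCoord_eq (lam := lam)
    (h := fun j' => (if j' = j then (1 : k) else 0) • C.charDual Vertex.c) (fun j' =>
      C.idem_smul_charDual_of_imp fun hj' => if_neg fun h => hj' (by rw [h, hj]))
  obtain ⟨t, rfl⟩ := hsurj η
  have h1 := congrFun hη j
  rw [dualCoord_dualD₁ hb, Finset.sum_eq_zero] at h1
  · have := congrArg (fun f : DualBimodule k C.Alg => f (C.idem Vertex.c)) h1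
    simp [charDual_apply, character_idem] at this
  · intro z _
    have h2 : C.idem (lam j) * C.arr z.1.1 = 0 := by
      rw [idem_mul_arr, if_neg]
      rw [hj]
      obtain ⟨⟨⟨i, a⟩, j'⟩, hz⟩ := z
      rcases a with ⟨_ | a, ha⟩
      · simp [source, vertexAt]
      · rw [C.source_eq_mid ha]
        simp
    have h3 : b.repr (op (C.arr z.1.1) • b z.1.2) j = 0 := by
      by_cases hz : target z.1.1 = Vertex.c
      · rw [hcon _ _ hz, map_zero, Finsupp.zero_apply]
      · rw [← idem_smul_op_arr_smul, hb.repr_idem_smul, if_neg]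
        rw [hj]
        exact Ne.symm hz
    rw [h2, h3, smul_zero, zero_smul, sub_zero, zero_smul]

end

/-- The arrows of an arm act alike on a finite dimensional Serre stable module with shift `1`, and
some arrow that ends at `c` does not act as zero if `M e_c ≠ 0`. -/
theorem IsSerreStable.actsSurj_iff {M : C.RMod} [Module.Finite k M] (hM : IsSerreStable k 1 M) :
    (∀ (i : Fin C.n) (a : ℕ) (h : a + 1 < C.p i),
      ActsSurj (C.idem (target (⟨i, ⟨a + 1, h⟩⟩ : Arrow C.p))) (C.arr ⟨i, ⟨a + 1, h⟩⟩) M ↔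
      ActsSurj (C.idem (target (⟨i, ⟨a, by omega⟩⟩ : Arrow C.p))) (C.arr ⟨i, ⟨a, by omega⟩⟩) M) ∧
    (C.dimVec M Vertex.c ≠ 0 →
      ∃ (α : Arrow C.p) (x : M), target α = Vertex.c ∧ op (C.arr α) • x ≠ 0) := by
  have hb := C.isVertexBasis_vertexBasis M
  have hlam : C.dimVec M Vertex.c ≠ 0 → ∃ j, C.basisVertex M j = Vertex.c := fun h =>
    ⟨⟨Vertex.c, ⟨0, Nat.pos_of_ne_zero fun h0 => h (by rw [dimVec, h0, Nat.cast_zero])⟩⟩, rfl⟩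
  generalize C.vertexBasis M = b at hb
  generalize C.basisVertex M = lam at b hb hlam
  have w : ModuleCat.ofHom (C.resD₂ lam b) ≫ ModuleCat.ofHom (C.resD₁ lam b) = 0 :=
    ModuleCat.hom_ext (resD₁_comp_resD₂ hb)
  have h : (ShortComplex.mk _ _ w).Exact :=
    (ShortComplex.ShortExact.moduleCat_exact_iff_function_exact _).2 (exact_resD₂_resD₁ hb)
  have w' : ModuleCat.ofHom (C.resD₁ lam b) ≫ (ModuleCat.ofHom (C.resAug lam b) : _ ⟶ M) = 0 :=
    ModuleCat.hom_ext (resAug_comp_resD₁ hb)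
  have h' : (ShortComplex.mk _ _ w').Exact :=
    (ShortComplex.ShortExact.moduleCat_exact_iff_function_exact _).2 (exact_resD₁_resAug hb)
  have : Mono (ModuleCat.ofHom (C.resD₂ lam b)) :=
    (ModuleCat.mono_iff_injective _).2 (injective_resD₂ hb)
  have : Epi (ModuleCat.ofHom (C.resAug lam b) : _ ⟶ M) :=
    (ModuleCat.epi_iff_surjective _).2 (surjective_resAug hb)
  have hsurj : Function.Surjective (C.dualD₁ lam b) := (ModuleCat.epi_iff_surjective _).1
    (epi_map_of_isZero_leftDerived_zero _ _ _ (tensorDual k C.Alg) w h w' h' (hM.1 0 zero_ne_one))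
  have w'' : (tensorDual k C.Alg).map (ModuleCat.ofHom (C.resD₂ lam b)) ≫
      (tensorDual k C.Alg).map (ModuleCat.ofHom (C.resD₁ lam b)) = 0 := by
    rw [← Functor.map_comp, w, Functor.map_zero]
  obtain ⟨φ⟩ := hM.2
  obtain ⟨ψ⟩ := nonempty_leftDerived_one_iso _ _ _ (tensorDual k C.Alg) w h w' h' w''
  refine ⟨fun i a ha => ?_, fun hc => ?_⟩
  · rw [actsSurj_congr (φ ≪≫ ψ), actsSurj_homology_iff (C.idem_mul_self _)]
    refine ⟨fun hH x hx => C.exists_smul_eq_of_cycle hb hsurj ha hH hx,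
      fun hX z' hz' hz'e => ?_⟩
    obtain ⟨z, hz, hzz⟩ := C.exists_cycle_of_actsSurj hb ha hX hz' hz'e
    exact ⟨z, 0, hz, by rw [map_zero, add_zero]; exact hzz⟩
  · obtain ⟨j, hj⟩ := hlam hc
    exact C.exists_arrow_smul_ne_zero hb hsurj hj

/-! ### Thin modules -/

section Thin

variable {C}

/-- The vectors `m v` span the spaces of the vertices of `M`, which are all one-dimensional. -/
structure IsThinBasis (M : C.RMod) (m : Vertex C.p → M) : Prop where
  idem_smul : ∀ v, op (C.idem v) • m v = m v
  ne_zero : ∀ v, m v ≠ 0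
  exists_smul : ∀ v (x : M), op (C.idem v) • x = x → ∃ c : k, c • m v = x

theorem exists_isThinBasis {M : C.RMod} (hM : C.dimVec M = 1) :
    Module.Finite k M ∧ ∃ m, IsThinBasis M m := by
  have h1 (v : Vertex C.p) : Module.finrank k (C.vertexSpace M v) = 1 := by
    have := congrFun hM v
    rw [dimVec, Pi.one_apply] at this
    exact_mod_cast this
  have (v : Vertex C.p) : Module.Finite k (C.vertexSpace M v) :=
    Module.finite_of_finrank_eq_succ (h1 v)
  refine ⟨Module.Finite.equiv (C.vertexEquiv M).symm, ?_⟩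
  choose m hm0 hm using fun v => finrank_eq_one_iff'.1 (h1 v)
  refine ⟨fun v => (m v).1, fun v => (m v).2, fun v h => hm0 v (Subtype.ext h), fun v x hx => ?_⟩
  obtain ⟨c, hc⟩ := hm v ⟨x, hx⟩
  exact ⟨c, congrArg Subtype.val hc⟩

namespace IsThinBasis

variable {M : C.RMod} {m : Vertex C.p → M} (hm : IsThinBasis M m)
include hm

theorem mem_of_mem {N : Submodule C.Algᵐᵒᵖ M} {x : M} (hx : x ∈ N) {v : Vertex C.p}
    (h : op (C.idem v) • x ≠ 0) : m v ∈ N := by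
  obtain ⟨c, hc⟩ := hm.exists_smul v (op (C.idem v) • x)
    (by rw [← mul_smul, ← op_mul, idem_mul_self])
  have hc0 : c ≠ 0 := fun h0 => h (by rw [← hc, h0, zero_smul])
  have h2 : m v = algebraMap k C.Algᵐᵒᵖ c⁻¹ • op (C.idem v) • x := by
    rw [← hc, algebraMap_smul, inv_smul_smul₀ hc0]
  rw [h2]
  exact N.smul_mem _ (N.smul_mem _ hx)

/-- A submodule of a thin module is determined by the vertices that it contains. -/
theorem le_of_forall {N N' : Submodule C.Algᵐᵒᵖ M} (h : ∀ v, m v ∈ N → m v ∈ N') : N ≤ N' := by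
  intro x hx
  rw [← C.sum_idem_smul x]
  refine N'.sum_mem fun v _ => ?_
  by_cases h0 : op (C.idem v) • x = 0
  · rw [h0]
    exact N'.zero_mem
  · obtain ⟨c, hc⟩ := hm.exists_smul v (op (C.idem v) • x)
      (by rw [← mul_smul, ← op_mul, idem_mul_self])
    rw [← hc, ← algebraMap_smul C.Algᵐᵒᵖ c]
    exact N'.smul_mem _ (h v (hm.mem_of_mem hx h0))

theorem exists_mem_of_ne_bot {N : Submodule C.Algᵐᵒᵖ M} (h : N ≠ ⊥) : ∃ v, m v ∈ N := by
  by_contra! hcon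
  exact h (le_bot_iff.1 (hm.le_of_forall fun v hv => absurd hv (hcon v)))

theorem mem_or_mem {N N' : Submodule C.Algᵐᵒᵖ M} (h : N ⊔ N' = ⊤) (v : Vertex C.p) :
    m v ∈ N ∨ m v ∈ N' := by
  obtain ⟨x, hx, y, hy, hxy⟩ := Submodule.mem_sup.1 (h ▸ Submodule.mem_top : m v ∈ N ⊔ N')
  by_contra! hcon
  have hx0 : op (C.idem v) • x = 0 := by
    by_contra h0
    exact hcon.1 (hm.mem_of_mem hx h0)
  have hy0 : op (C.idem v) • y = 0 := by
    by_contra h0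
    exact hcon.2 (hm.mem_of_mem hy h0)
  exact hm.ne_zero v (by rw [← hm.idem_smul, ← hxy, smul_add, hx0, hy0, add_zero])

open Classical in
theorem dimVec_eq {X : C.RMod} {f : X →ₗ[C.Algᵐᵒᵖ] M} (hf : Function.Injective f)
    (v : Vertex C.p) : C.dimVec X v = if m v ∈ LinearMap.range f then 1 else 0 := by
  rw [dimVec]
  split_ifs with h
  · obtain ⟨x, hx⟩ := h
    have : Module.finrank k (C.vertexSpace X v) = 1 := by
      refine finrank_eq_one_iff'.2 ⟨⟨x, hf ?_⟩, fun h0 => ?_, fun y => ?_⟩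
      · rw [map_smul, hx, hm.idem_smul]
      · have : x = 0 := congrArg Subtype.val h0
        exact hm.ne_zero v (by rw [← hx, this, map_zero])
      · obtain ⟨c, hc⟩ := hm.exists_smul v (f y.1) (by rw [← map_smul]; exact congrArg f y.2)
        refine ⟨c, Subtype.ext (hf ?_)⟩
        have h1 : f (algebraMap k C.Algᵐᵒᵖ c • x) = f y.1 := by
          rw [map_smul, hx, algebraMap_smul, hc]
        rw [algebraMap_smul] at h1
        exact h1
    rw [this, Nat.cast_one]
  · have : Subsingleton (C.vertexSpace X v) := by
      refine subsingleton_of_forall_eq 0 fun y => Subtype.ext (hf ?_)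
      by_contra h0
      refine h (hm.mem_of_mem (LinearMap.mem_range_self f y.1) ?_)
      rw [← map_smul, C.mem_vertexSpace.1 y.2]
      exact fun h1 => h0 (h1.trans (map_zero f).symm)
    rw [Module.finrank_zero_of_subsingleton, Nat.cast_zero]

open Classical in
theorem eulerForm_one_eq {X : C.RMod} {f : X →ₗ[C.Algᵐᵒᵖ] M} (hf : Function.Injective f) :
    C.eulerForm 1 (C.dimVec X) = (if m Vertex.zero ∈ LinearMap.range f then 1 else 0) -
      if m Vertex.c ∈ LinearMap.range f then 1 else 0 := by
  rw [eulerForm_one, hm.dimVec_eq hf, hm.dimVec_eq hf]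

theorem arr_smul_eq (α : Arrow C.p) : ∃ c : k, c • m (target α) = op (C.arr α) • m (source α) :=
  hm.exists_smul _ _ (C.idem_smul_op_arr_smul _ _)

theorem arr_smul_ne_zero {α : Arrow C.p} {x : M} (h : op (C.arr α) • x ≠ 0) :
    op (C.arr α) • m (source α) ≠ 0 := by
  obtain ⟨c, hc⟩ := hm.exists_smul (source α) (op (C.idem (source α)) • x)
    (by rw [← mul_smul, ← op_mul, idem_mul_self])
  rw [← op_arr_smul_idem_smul, ← hc, smul_algebra_smul_comm] at h
  exact fun h0 => h (by rw [h0, smul_zero])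

theorem actsSurj_iff (α : Arrow C.p) :
    ActsSurj (C.idem (target α)) (C.arr α) M ↔ op (C.arr α) • m (source α) ≠ 0 := by
  constructor
  · intro h
    obtain ⟨y, hy⟩ := h _ (hm.idem_smul (target α))
    exact hm.arr_smul_ne_zero (hy.trans_ne (hm.ne_zero _))
  · intro h x hx
    obtain ⟨c, hc⟩ := hm.arr_smul_eq α
    obtain ⟨d, hd⟩ := hm.exists_smul _ x hx
    have hc0 : c ≠ 0 := fun h0 => h (by rw [← hc, h0, zero_smul])
    refine ⟨(d * c⁻¹) • m (source α), ?_⟩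
    rw [smul_algebra_smul_comm, ← hc, smul_smul, mul_assoc, inv_mul_cancel₀ hc0, mul_one, hd]

theorem target_mem {α : Arrow C.p} (hα : op (C.arr α) • m (source α) ≠ 0)
    {N : Submodule C.Algᵐᵒᵖ M} (h : m (source α) ∈ N) : m (target α) ∈ N :=
  hm.mem_of_mem (N.smul_mem (op (C.arr α)) h) (by rwa [idem_smul_op_arr_smul])

/-- The submodule of a thin module that is spanned by a set of vertices closed under the arrows
that do not act as zero. -/
def span (V : Set (Vertex C.p))
    (hV : ∀ α, source α ∈ V → op (C.arr α) • m (source α) ≠ 0 → target α ∈ V) :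
    Submodule C.Algᵐᵒᵖ M where
  carrier := {x | ∀ v, v ∉ V → op (C.idem v) • x = 0}
  zero_mem' v _ := smul_zero _
  add_mem' {x y} hx hy v hv := by rw [smul_add, hx v hv, hy v hv, add_zero]
  smul_mem' a x hx := by
    obtain ⟨a, rfl⟩ := op_surjective a
    induction a using alg_induction generalizing x with
    | algebraMap c =>
      intro v hv
      rw [← mul_smul, ← op_mul, Algebra.commutes, op_mul, mul_smul, hx v hv, smul_zero]
    | idem w =>
      intro v hv
      rw [← mul_smul, ← op_mul, idem_mul_idem]
      split_ifs with h
      · rw [h, hx v hv]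
      · rw [op_zero, zero_smul]
    | arr α =>
      intro v hv
      by_contra h0
      by_cases hvα : target α = v
      · subst hvα
        rw [idem_smul_op_arr_smul] at h0
        have h1 : source α ∈ V := by
          by_contra h1
          exact h0 (by rw [← op_arr_smul_idem_smul, hx _ h1, smul_zero])
        exact hv (hV α h1 (hm.arr_smul_ne_zero h0))
      · rw [← idem_smul_op_arr_smul, ← mul_smul, ← op_mul, C.idem_mul_of_ne hvα, op_zero,
          zero_smul] at h0
        exact h0 rfl
    | mul a b ha hb =>
      rw [op_mul, mul_smul]
      exact hb _ (ha _ hx)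
    | add a b ha hb =>
      intro v hv
      rw [MulOpposite.op_add, add_smul, smul_add, ha _ hx v hv, hb _ hx v hv, add_zero]

theorem mem_span {V : Set (Vertex C.p)}
    (hV : ∀ α, source α ∈ V → op (C.arr α) • m (source α) ≠ 0 → target α ∈ V) {v : Vertex C.p} :
    m v ∈ hm.span V hV ↔ v ∈ V := by
  constructor
  · intro h
    by_contra hv
    exact hm.ne_zero v ((hm.idem_smul v).symm.trans (h v hv))
  · intro h w hw
    rw [← hm.idem_smul v, ← mul_smul, ← op_mul,
      C.idem_mul_of_ne (fun h' : v = w => hw (h' ▸ h)), op_zero, zero_smul]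

end IsThinBasis

end Thin

/-! ### Blocks of thin modules -/

section Blocks

variable {C}

open Classical in
/-- The representative of the block of a vertex: the vertices inside the arms that are not `live`
are isolated, all other vertices form one block, represented by `c`. -/
def block (live : Fin C.n → Prop) : Vertex C.p → Vertex C.p
  | Vertex.zero => Vertex.c
  | Vertex.mid i a => if live i then Vertex.c else Vertex.mid i a
  | Vertex.c => Vertex.c

theorem block_eq (live : Fin C.n → Prop) (v : Vertex C.p) :
    block live v = Vertex.c ∨ block live v = v := by
  rcases v with _ | ⟨i, a⟩ | _
  · exact Or.inl rfl
  · rw [block]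
    split_ifs
    · exact Or.inl rfl
    · exact Or.inr rfl
  · exact Or.inl rfl

theorem block_block (live : Fin C.n → Prop) (v : Vertex C.p) :
    block live (block live v) = block live v := by
  rcases block_eq live v with h | h
  · rw [h]
    rfl
  · rw [h, h]

theorem block_vertexAt {live : Fin C.n → Prop} {i : Fin C.n} (hi : live i) (a : ℕ) :
    block live (vertexAt C.p i a) = Vertex.c := by
  rw [vertexAt]
  split_ifs
  · rfl
  · exact if_pos hi
  · rfl

/-- On a thin module with the basis `m`, the arrows of an arm act all by zero or all as nonzero
maps, according to whether the arm is `live`, and there is a live arm. -/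
structure IsLive {M : C.RMod} (m : Vertex C.p → M) (live : Fin C.n → Prop) : Prop where
  smul_ne_zero_iff : ∀ α : Arrow C.p, op (C.arr α) • m (source α) ≠ 0 ↔ live α.1
  exists_live : ∃ i, live i

/-- By Serre stability the arrows of an arm act alike. -/
theorem IsKPoint.exists_isLive {M : C.RMod} (hM : C.IsKPoint M) :
    Module.Finite k M ∧ ∃ m live, IsThinBasis M m ∧ IsLive m live := by
  obtain ⟨hfin, m, hm⟩ := exists_isThinBasis hM.1
  obtain ⟨h1, h2⟩ := IsSerreStable.actsSurj_iff C hM.2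
  have h3 (i : Fin C.n) (a : ℕ) (ha : a < C.p i) :
      ActsSurj (C.idem (target (⟨i, ⟨a, ha⟩⟩ : Arrow C.p))) (C.arr ⟨i, ⟨a, ha⟩⟩) M ↔
      ActsSurj (C.idem (target (⟨i, ⟨0, C.one_le i⟩⟩ : Arrow C.p))) (C.arr ⟨i, ⟨0, C.one_le i⟩⟩)
        M := by
    induction a with
    | zero => rfl
    | succ a ih => rw [h1, ih (by omega)]
  refine ⟨hfin, m, fun i => ActsSurj (C.idem (target (⟨i, ⟨0, C.one_le i⟩⟩ : Arrow C.p)))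
    (C.arr ⟨i, ⟨0, C.one_le i⟩⟩) M, hm, fun α => ?_, ?_⟩
  · rw [← hm.actsSurj_iff]
    exact h3 α.1 α.2.val α.2.isLt
  · obtain ⟨α, x, -, hα⟩ := h2 (by rw [hM.1]; exact one_ne_zero)
    exact ⟨α.1, (h3 α.1 α.2.val α.2.isLt).1 ((hm.actsSurj_iff α).2 (hm.arr_smul_ne_zero hα))⟩

variable {M : C.RMod} {m : Vertex C.p → M} {live : Fin C.n → Prop} (hm : IsThinBasis M m)
  (hl : IsLive m live)
include hm hl

namespace IsLive

theorem block_target {α : Arrow C.p} (h : op (C.arr α) • m (source α) ≠ 0) :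
    block live (target α) = block live (source α) := by
  have hα := (hl.smul_ne_zero_iff α).1 h
  rw [target, source, block_vertexAt hα, block_vertexAt hα]

/-- The submodule spanned by the blocks with representative in `B`. -/
def blockSpan (B : Set (Vertex C.p)) : Submodule C.Algᵐᵒᵖ M :=
  hm.span (block live ⁻¹' B) fun _ h h0 => by
    rw [Set.mem_preimage, hl.block_target hm h0]
    exact h

theorem mem_blockSpan {B : Set (Vertex C.p)} {v : Vertex C.p} :
    m v ∈ hl.blockSpan hm B ↔ block live v ∈ B := hm.mem_span _

theorem disjoint_blockSpan {B B' : Set (Vertex C.p)} (h : Disjoint B B') :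
    Disjoint (hl.blockSpan hm B) (hl.blockSpan hm B') := by
  rw [disjoint_iff]
  by_contra h0
  obtain ⟨v, hv, hv'⟩ := hm.exists_mem_of_ne_bot h0
  exact Set.disjoint_left.1 h ((hl.mem_blockSpan hm).1 hv) ((hl.mem_blockSpan hm).1 hv')

/-- A submodule that contains a vertex of a live arm contains all later vertices of the arm. -/
theorem vertexAt_mem {i : Fin C.n} (hi : live i) {N : Submodule C.Algᵐᵒᵖ M} {a b : ℕ}
    (hab : a ≤ b) (hb : b ≤ C.p i) (h : m (vertexAt C.p i a) ∈ N) :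
    m (vertexAt C.p i b) ∈ N := by
  induction b, hab using Nat.le_induction with
  | base => exact h
  | succ b hab ih =>
    exact hm.target_mem (α := ⟨i, ⟨b, hb⟩⟩) ((hl.smul_ne_zero_iff _).2 hi) (ih (by omega))

theorem c_mem {N : Submodule C.Algᵐᵒᵖ M} {v : Vertex C.p} (hv : block live v = Vertex.c)
    (h : m v ∈ N) : m Vertex.c ∈ N := by
  rcases v with _ | ⟨i, a⟩ | _
  · obtain ⟨i, hi⟩ := hl.exists_live
    rw [← C.vertexAt_length i]
    exact hl.vertexAt_mem hm hi (Nat.zero_le _) le_rfl h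
  · have hi : live i := by
      by_contra hi
      rw [block, if_neg hi] at hv
      exact absurd hv (by simp)
    rw [← C.vertexAt_length i]
    rw [← C.vertexAt_mid] at h
    exact hl.vertexAt_mem hm hi (by omega) le_rfl h
  · exact h

theorem mem_of_zero_mem {N : Submodule C.Algᵐᵒᵖ M} {v : Vertex C.p}
    (hv : block live v = Vertex.c) (h : m Vertex.zero ∈ N) : m v ∈ N := by
  rcases v with _ | ⟨i, a⟩ | _
  · exact h
  · have hi : live i := by
      by_contra hi
      rw [block, if_neg hi] at hv
      exact absurd hv (by simp)
    rw [← C.vertexAt_mid]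
    exact hl.vertexAt_mem hm hi (Nat.zero_le _) (by omega) h
  · exact hl.c_mem hm (v := Vertex.zero) rfl h

/-- A nonzero proper submodule of a block of `M` contains the vertex `c`, but not the vertex
`0`. -/
theorem of_lt_blockSpan {N : Submodule C.Algᵐᵒᵖ M} {v : Vertex C.p} (hN0 : N ≠ ⊥)
    (hN : N < hl.blockSpan hm {v}) : m Vertex.c ∈ N ∧ m Vertex.zero ∉ N := by
  obtain ⟨w, hw⟩ := hm.exists_mem_of_ne_bot hN0
  have hwv : block live w = v := (hl.mem_blockSpan hm).1 (hN.le hw)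
  have hvc : v = Vertex.c := by
    by_contra hvc
    refine hN.not_ge (hm.le_of_forall fun u hu => ?_)
    have huv : block live u = v := (hl.mem_blockSpan hm).1 hu
    have hu' : v = u := huv.symm.trans ((block_eq live u).resolve_left fun h => hvc (huv ▸ h))
    have hw' : v = w := hwv.symm.trans ((block_eq live w).resolve_left fun h => hvc (hwv ▸ h))
    rw [← hu', hw']
    exact hw
  refine ⟨hl.c_mem hm (hwv.trans hvc) hw, fun h0 => ?_⟩
  refine hN.not_ge (hm.le_of_forall fun u hu => hl.mem_of_zero_mem hm ?_ h0)
  exact ((hl.mem_blockSpan hm).1 hu).trans hvc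

theorem eulerForm_of_lt_blockSpan {X : C.RMod} {f : X →ₗ[C.Algᵐᵒᵖ] M}
    (hf : Function.Injective f) {v : Vertex C.p} (h0 : LinearMap.range f ≠ ⊥)
    (h : LinearMap.range f < hl.blockSpan hm {v}) : C.eulerForm 1 (C.dimVec X) = -1 := by
  obtain ⟨h1, h2⟩ := hl.of_lt_blockSpan hm h0 h
  rw [hm.eulerForm_one_eq hf, if_neg h2, if_pos h1, zero_sub]

theorem isRegularSimple_blockSpan [Module.Finite k M] {v : Vertex C.p} (hv : block live v = v) :
    C.IsRegularSimple 1 (ModuleCat.of C.Algᵐᵒᵖ (hl.blockSpan hm {v})) := by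
  have hinj : Function.Injective (hl.blockSpan hm {v}).subtype := Submodule.injective_subtype _
  refine ⟨?_, ?_, ?_, fun N hN hN' => ?_⟩
  · exact (Submodule.nontrivial_iff_ne_bot).2 fun h =>
      hm.ne_zero v ((Submodule.mem_bot _).1 (h ▸ (hl.mem_blockSpan hm).2 hv))
  · let f : ModuleCat.of C.Algᵐᵒᵖ (hl.blockSpan hm {v}) →ₗ[C.Algᵐᵒᵖ] M :=
      (hl.blockSpan hm {v}).subtype
    exact Module.Finite.of_injective (f.restrictScalars k) hinj
  · rw [hm.eulerForm_one_eq (X := ModuleCat.of C.Algᵐᵒᵖ (hl.blockSpan hm {v})) hinj,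
      Submodule.range_subtype, mem_blockSpan, mem_blockSpan]
    exact sub_self _
  · have h := hl.eulerForm_of_lt_blockSpan hm (X := ModuleCat.of C.Algᵐᵒᵖ N) (v := v)
      (f := (hl.blockSpan hm {v}).subtype ∘ₗ N.subtype) (hinj.comp (Submodule.injective_subtype _))
      (fun h0 => hN ?_) (lt_of_le_of_ne ?_ fun h0 => hN' ?_)
    · rw [h]
      exact neg_one_lt_zero
    · rw [LinearMap.range_comp, Submodule.range_subtype] at h0
      exact Submodule.map_injective_of_injective hinj (h0.trans (Submodule.map_bot _).symm)
    · rintro _ ⟨x, rfl⟩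
      exact x.1.2
    · rw [LinearMap.range_comp, Submodule.range_subtype] at h0
      refine Submodule.map_injective_of_injective hinj ?_
      rw [h0, Submodule.map_top, Submodule.range_subtype]

/-- `M` is the direct sum of its blocks. -/
theorem isRegularSemisimple [Module.Finite k M] : C.IsRegularSemisimple 1 M := by
  let ι := {v : Vertex C.p // block live v = v}
  let e : ι ≃ Fin (Nat.card ι) := Finite.equivFin ι
  have hint : iSupIndep fun v : ι => hl.blockSpan hm {v.1} := by
    intro v
    refine (hl.disjoint_blockSpan hm (B' := {v.1}ᶜ) disjoint_compl_right).mono_right ?_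
    refine iSup₂_le fun w hw => hm.le_of_forall fun u hu => ?_
    rw [mem_blockSpan] at hu ⊢
    rw [Set.mem_singleton_iff.1 hu]
    exact fun h => hw (Subtype.ext h)
  refine ⟨Nat.card ι, fun j => hl.blockSpan hm {(e.symm j).1}, ?_, fun j =>
    hl.isRegularSimple_blockSpan hm (e.symm j).2⟩
  rw [DirectSum.isInternal_submodule_iff_iSupIndep_and_iSup_eq_top]
  refine ⟨hint.comp e.symm.injective, top_le_iff.1 (hm.le_of_forall fun v _ => ?_)⟩
  have h1 := le_iSup (fun j => hl.blockSpan hm {(e.symm j).1}) (e ⟨_, block_block live v⟩)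
  refine h1 ((hl.mem_blockSpan hm).2 ?_)
  rw [Equiv.symm_apply_apply]
  rfl

/-- The indecomposable direct summands of `M` are its blocks. -/
theorem exists_eq_blockSpan {L : Submodule C.Algᵐᵒᵖ M} (hL : C.IsIndecSummand M L) :
    ∃ v, L = hl.blockSpan hm {v} := by
  obtain ⟨hL0, ⟨L', hL'⟩, hindec⟩ := hL
  obtain ⟨w, hw⟩ := hm.exists_mem_of_ne_bot hL0
  have hle : L ≤ hl.blockSpan hm {block live w} := by
    have hdisj := hl.disjoint_blockSpan hm (B := {block live w}) (B' := {block live w}ᶜ)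
      disjoint_compl_right
    have hsup : L ⊓ hl.blockSpan hm {block live w} ⊔ L ⊓ hl.blockSpan hm {block live w}ᶜ = L := by
      refine le_antisymm (sup_le inf_le_left inf_le_left) (hm.le_of_forall fun v hv => ?_)
      by_cases h : block live v = block live w
      · exact Submodule.mem_sup_left ⟨hv, (hl.mem_blockSpan hm).2 h⟩
      · exact Submodule.mem_sup_right ⟨hv, (hl.mem_blockSpan hm).2 h⟩
    rcases hindec _ _ (hdisj.mono inf_le_right inf_le_right) hsup with h | h
    · have : m w ∈ L ⊓ hl.blockSpan hm {block live w} := ⟨hw, (hl.mem_blockSpan hm).2 rfl⟩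
      rw [h, Submodule.mem_bot] at this
      exact absurd this (hm.ne_zero w)
    · rw [h, sup_bot_eq] at hsup
      exact inf_eq_left.1 hsup
  refine ⟨block live w, eq_of_le_of_not_lt hle fun hlt => ?_⟩
  -- Otherwise the complement contains the vertex `0`, hence also the vertex `c`.
  obtain ⟨hc, h0⟩ := hl.of_lt_blockSpan hm hL0 hlt
  have hc' : m Vertex.c ∈ L' :=
    hl.c_mem hm (v := Vertex.zero) rfl ((hm.mem_or_mem hL'.sup_eq_top Vertex.zero).resolve_left h0)
  exact hm.ne_zero _ (Submodule.disjoint_def.1 hL'.disjoint _ hc hc')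

end IsLive

end Blocks

end CanonicalDatum

end

end SerreStable


theorem mainTheorem9 {k : Type u} [Field k] (C : SerreStable.CanonicalDatum k) :
    (∀ X Y : C.RMod, Module.Finite k X → Module.Finite k Y →
      (∀ i : ℕ, Module.Finite k (CategoryTheory.Abelian.Ext X Y i)) ∧
      (∃ m : ℕ, ∀ i : ℕ, m ≤ i → Subsingleton (CategoryTheory.Abelian.Ext X Y i)) ∧
      C.eulerForm (C.dimVec X) (C.dimVec Y) = SerreStable.eulerChar k X Y) ∧
    ∀ M : C.RMod, C.IsKPoint M →
      C.IsRegularSemisimple 1 M ∧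
      ∀ L : Submodule (C.Alg)ᵐᵒᵖ M, C.IsIndecSummand M L →
        ∀ N : Submodule (C.Alg)ᵐᵒᵖ M, N ≤ L → N ≠ ⊥ → N ≠ L →
          C.eulerForm 1 (C.dimVec (ModuleCat.of (C.Alg)ᵐᵒᵖ N)) = -1 := by
  refine ⟨fun X Y hX hY => ?_, fun M hM => ?_⟩
  · obtain ⟨⟨h1, h2⟩, h3⟩ := C.extFinite_and_eulerChar X Y
    exact ⟨h1, h2, by rw [h3, C.eulerForm_eq_quiverForm]⟩
  · obtain ⟨hfin, m, live, hm, hl⟩ := hM.exists_isLive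
    refine ⟨hl.isRegularSemisimple hm, fun L hL N hNL hN0 hN => ?_⟩
    obtain ⟨v, rfl⟩ := hl.exists_eq_blockSpan hm hL
    exact hl.eulerForm_of_lt_blockSpan hm (X := ModuleCat.of C.Algᵐᵒᵖ N) (f := N.subtype)
      (Submodule.injective_subtype _) (by rwa [Submodule.range_subtype])
      (by rw [Submodule.range_subtype]; exact lt_of_le_of_ne hNL hN)
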